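/- There are universal constants $C>0$ and $c\in\mathbb{N}$ such that the following holds for all integers $0\le k\le d$, all $\varepsilon\in(0,1)$ and all real $s\ge 1$. Let $\mathcal{F}$ be the class of all functions $f:\mathbb{R}^d\to\{\pm1\}$ such that the set $\{x: f(x)=1\}$ is convex and $f$ has intrinsic dimension $k$, i.e. $f(x)=F(Wx)$ for all $x\in\mathbb{R}^d$, for some $F:\mathbb{R}^k\to\{\pm1\}$ and some $W\in\mathbb{R}^{k\times d}$ with $WW^\top=I_{k\times k}$. Put $$X=\frac{k^{5/2}\,s}{(\varepsilon/2)^{s+1}} .$$ Then the $(\varepsilon,s)$-sandwiching degree of $\mathcal{F}$ with respect to the standard Gaussian distribution $\mathcal{N}(0,I_{d\times d})$ is at most $$\bigl(C\,X\,(\log(2+X))^{c}\bigr)^{2}=\widetilde{O}(X)^{2}.$$ Here the $(\varepsilon,s)$-sandwiching degree of $f$ is the least $\ell\in\mathbb{N}$ for which there are real polynomials $p_{\mathrm{up}},p_{\mathrm{down}}$ in $d$ variables, of total degree at most $\ell$, such that $p_{\mathrm{down}}(x)\le f(x)\le p_{\mathrm{up}}(x)$ for all $x\in\mathbb{R}^d$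 and $\bigl(\mathbb{E}_{x\sim\mathcal{N}(0,I_{d\times d})}[|p_{\mathrm{up}}(x)-p_{\mathrm{down}}(x)|^s]\bigr)^{1/s}\le\varepsilon$ ($+\infty$ if there is no such $\ell$), and the sandwiching degree of a class is the supremum over its elements. -/

import Mathlib

open MeasureTheory ProbabilityTheory
open scoped ENNReal

noncomputable section

/-- A concept on `ℝ^d` is a function with values in `{1, -1}`. -/
def IsConcept {d : ℕ} (f : EuclideanSpace ℝ (Fin d) → ℝ) : Prop :=
  ∀ x, f x = 1 ∨ f x = -1

/-- The value of a real polynomial in `d` variables at a point of `ℝ^d`. -/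
def polyEval {d : ℕ} (p : MvPolynomial (Fin d) ℝ) (x : EuclideanSpace ℝ (Fin d)) : ℝ :=
  MvPolynomial.eval (fun i => x i) p

/-- There are polynomials `pdown ≤ f ≤ pup` (pointwise, everywhere) of total degree at most `ℓ`
whose difference has norm `(E |pup - pdown| ^ s) ^ (1 / s)` at most `ε` under `μ`. -/
def HasSandwichingPolynomials {d : ℕ} (f : EuclideanSpace ℝ (Fin d) → ℝ)
    (μ : Measure (EuclideanSpace ℝ (Fin d))) (ε s : ℝ) (ℓ : ℕ) : Prop :=
  ∃ pup pdown : MvPolynomial (Fin d) ℝ,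
    pup.totalDegree ≤ ℓ ∧ pdown.totalDegree ≤ ℓ ∧
    (∀ x, polyEval pdown x ≤ f x ∧ f x ≤ polyEval pup x) ∧
    eLpNorm (fun x => polyEval pup x - polyEval pdown x) (ENNReal.ofReal s) μ ≤ ENNReal.ofReal ε

/-- The `(ε, s)`-sandwiching degree of `f` with respect to `μ`: the least degree for which
sandwiching polynomials exist (`⊤` if there are none of any degree). -/
def sandwichingDegree {d : ℕ} (f : EuclideanSpace ℝ (Fin d) → ℝ)
    (μ : Measure (EuclideanSpace ℝ (Fin d))) (ε s : ℝ) : ℕ∞ :=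
  ⨅ (ℓ : ℕ) (_ : HasSandwichingPolynomials f μ ε s ℓ), (ℓ : ℕ∞)

/-- The sandwiching degree of a concept class: the supremum over its elements. -/
def classSandwichingDegree {d : ℕ} (𝓕 : Set (EuclideanSpace ℝ (Fin d) → ℝ))
    (μ : Measure (EuclideanSpace ℝ (Fin d))) (ε s : ℝ) : ℕ∞ :=
  ⨆ f ∈ 𝓕, sandwichingDegree f μ ε s

/-- `f` has intrinsic dimension `k`: `f x = F (W x)` for a concept `F` on `ℝ^k` and a `k × d`
matrix `W` with orthonormal rows. -/
def HasIntrinsicDim {d : ℕ} (f : EuclideanSpace ℝ (Fin d) → ℝ) (k : ℕ) : Prop :=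
  ∃ (F : EuclideanSpace ℝ (Fin k) → ℝ) (W : Matrix (Fin k) (Fin d) ℝ),
    IsConcept F ∧ W * W.transpose = 1 ∧
    ∀ x, f x = F (WithLp.toLp 2 (W.mulVec (fun i => x i)))

/-- The concepts on `ℝ^d` of intrinsic dimension `k` that indicate a convex set. -/
def convexConcepts (d k : ℕ) : Set (EuclideanSpace ℝ (Fin d) → ℝ) :=
  {f | IsConcept f ∧ Convex ℝ {x | f x = 1} ∧ HasIntrinsicDim f k}

end

/-! Since the rows of `W` are orthonormal, `W` maps the Gaussian on `ℝ^d` to the Gaussian on `ℝ^k`,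
so it suffices to sandwich the concept `F` of a convex `K ⊆ ℝ^k` and compose with `W`.

Write `e = ε/2`. The functions `cutoff K δ` and `-cutoff Kᶜ δ` are `2/δ`-Lipschitz, lie above and
below `F`, and differ only within `δ` of the boundary of `K`. That layer has Gaussian measure `O(√k
δ)` (`exists_stdGaussian_boundaryLayer_le`): by convexity, few points of a convex set leave it under
a fixed translation (`stdGaussian_crossing_le`), while a random Gaussian translation of size about
`δ` expels a layer point from the `δ`-thickening of `K` with constant probability. Hence `δ ~
e^s/√k`.

On the cube `[-R, R]^k` a positive tensor Jackson operator approximates these functions with error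
`O(√k R/(pδ))` and degree `2pk` (`abs_tensorOp_sub_le`). Outside the cube it is at most `∑ (6
y_i/R)^(2pk)`, itself a polynomial, so adding a multiple of it restores the inequalities everywhere
(`exists_poly_sandwich`). Taking `R² ~ pks` makes this term exponentially small in `L^s`. The cube
error is then `O(k √(s/p)/δ)`, and requiring it to be `O(e/s)` gives `p ~ k³s³/e^(2s+2)`. The degree
`O(k⁴s³/e^(2s+2))` exceeds `X²` by at most a factor `O(s)`, and `s ≤ log(2+X)²` because `X ≥
2^(s+1)`. -/

/-! ### Jackson kernels and positive polynomial weights on `[-1, 1]` -/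

section JacksonKernel

/-- The nonnegative trigonometric polynomial `|∑ c_l e^{ilt}|²`, written as a cosine sum. -/
noncomputable def sqKernel (c : ℕ → ℝ) (n : ℕ) (t : ℝ) : ℝ :=
  ∑ l ∈ Finset.range n, ∑ m ∈ Finset.range n, c l * c m * Real.cos (((l : ℝ) - m) * t)

lemma sqKernel_eq (c : ℕ → ℝ) (n : ℕ) (t : ℝ) :
    sqKernel c n t = (∑ l ∈ Finset.range n, c l * Real.cos (l * t)) ^ 2 +
      (∑ l ∈ Finset.range n, c l * Real.sin (l * t)) ^ 2 := by
  rw [sq, sq, Finset.sum_mul_sum, Finset.sum_mul_sum, ← Finset.sum_add_distrib]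
  refine Finset.sum_congr rfl fun l _ => ?_
  rw [← Finset.sum_add_distrib]
  refine Finset.sum_congr rfl fun m _ => ?_
  rw [sub_mul, Real.cos_sub]; ring

lemma sqKernel_nonneg (c : ℕ → ℝ) (n : ℕ) (t : ℝ) : 0 ≤ sqKernel c n t := by
  rw [sqKernel_eq]; positivity

/-- Multiplication by `|1 - e^{it}|²` passes to the differenced coefficients. -/
lemma sqKernel_diff (c : ℕ → ℝ) (n : ℕ) (t : ℝ) (h0 : c 0 = 0) (hn : c n = 0) :
    2 * (1 - Real.cos t) * sqKernel c n t = sqKernel (fun l => c (l + 1) - c l) n t := by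
  have hsh : ∀ g : ℕ → ℝ, ∑ l ∈ Finset.range n, c (l + 1) * g (l + 1) =
      ∑ l ∈ Finset.range n, c l * g l := by
    intro g
    have := Finset.sum_range_succ (fun l => c l * g l) n
    rw [Finset.sum_range_succ', h0, hn] at this
    simpa using this
  have hc : ∑ l ∈ Finset.range n, (c (l + 1) - c l) * Real.cos (l * t) =
      Real.cos t * (∑ l ∈ Finset.range n, c l * Real.cos (l * t)) +
      Real.sin t * (∑ l ∈ Finset.range n, c l * Real.sin (l * t)) -
      ∑ l ∈ Finset.range n, c l * Real.cos (l * t) := by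
    simp_rw [sub_mul, Finset.sum_sub_distrib]
    have := hsh (fun l => Real.cos ((l - 1 : ℝ) * t))
    simp only [Nat.cast_add, Nat.cast_one, add_sub_cancel_right] at this
    rw [this, Finset.mul_sum, Finset.mul_sum, ← Finset.sum_add_distrib]
    congr 1
    refine Finset.sum_congr rfl fun l _ => ?_
    rw [sub_mul, Real.cos_sub, one_mul]; ring
  have hs : ∑ l ∈ Finset.range n, (c (l + 1) - c l) * Real.sin (l * t) =
      Real.cos t * (∑ l ∈ Finset.range n, c l * Real.sin (l * t)) -
      Real.sin t * (∑ l ∈ Finset.range n, c l * Real.cos (l * t)) -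
      ∑ l ∈ Finset.range n, c l * Real.sin (l * t) := by
    simp_rw [sub_mul, Finset.sum_sub_distrib]
    have := hsh (fun l => Real.sin ((l - 1 : ℝ) * t))
    simp only [Nat.cast_add, Nat.cast_one, add_sub_cancel_right] at this
    rw [this]
    congr 1
    rw [Finset.mul_sum, Finset.mul_sum, ← Finset.sum_sub_distrib]
    refine Finset.sum_congr rfl fun l _ => ?_
    rw [sub_mul, Real.sin_sub, one_mul]; ring
  rw [sqKernel_eq, sqKernel_eq, hc, hs]
  have h1 := Real.sin_sq_add_cos_sq t
  generalize (∑ l ∈ Finset.range n, c l * Real.cos (l * t)) = P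
  generalize (∑ l ∈ Finset.range n, c l * Real.sin (l * t)) = Q
  linear_combination (-(P ^ 2 + Q ^ 2)) * h1

lemma sum_cos_grid {N : ℕ} {r : ℤ} (hr : r ≠ 0) (hrN : |r| < N) (φ : ℝ) :
    ∑ j ∈ Finset.range N, Real.cos (r * (2 * Real.pi * j / N + φ)) = 0 := by
  have hN : 0 < N := by
    rcases Nat.eq_zero_or_pos N with h | h
    · subst h; simp at hrN; have := abs_nonneg r; omega
    · exact h
  have hN' : (N : ℝ) ≠ 0 := by positivity
  have hpi := Real.pi_ne_zero
  have h := Real.sum_cos N (a := r * (2 * Real.pi) / N) ?_ (r * φ)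
  · have h2 : ∀ j : ℕ, (r : ℝ) * (2 * Real.pi * j / N + φ) = r * (2 * Real.pi) / N * j + r * φ := by
      intro j; ring
    simp_rw [h2, h]
    have : (N : ℝ) * (r * (2 * Real.pi) / N) / 2 = r * Real.pi := by field_simp
    rw [this, Real.sin_int_mul_pi]; simp
  · intro k hk
    have h3 : (r : ℝ) = k * N := by
      field_simp at hk
      exact hk.trans (by ring)
    have h4 : r = k * N := by exact_mod_cast h3
    have hk0 : k ≠ 0 := by rintro rfl; simp at h4; exact hr h4
    have : (1 : ℤ) ≤ |k| := Int.one_le_abs hk0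
    rw [h4, abs_mul] at hrN
    simp only [Nat.abs_cast] at hrN
    nlinarith

/-- Nonzero frequencies `l - m` are smaller than `N` in absolute value, so they cancel over `N`
equally spaced points; only the diagonal survives, whatever the shift `φ`. -/
lemma sum_sqKernel_grid (c : ℕ → ℝ) {n N : ℕ} (hnN : n ≤ N) (φ : ℝ) :
    ∑ j ∈ Finset.range N, sqKernel c n (2 * Real.pi * j / N + φ) =
      N * ∑ l ∈ Finset.range n, c l ^ 2 := by
  unfold sqKernel
  rw [Finset.sum_comm, Finset.mul_sum]
  refine Finset.sum_congr rfl fun l hl => ?_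
  rw [Finset.sum_comm, Finset.sum_eq_single_of_mem l hl]
  · simp [sq]
  · intro m hm hml
    rw [← Finset.mul_sum]
    have h := sum_cos_grid (N := N) (r := (l : ℤ) - m) (by omega) (by
      simp only [Finset.mem_range] at hl hm
      rw [abs_lt]; omega) φ
    push_cast at h
    rw [h, mul_zero]

/-- The Jackson-type weight attached to the node `cos (2πj/N)`. -/
noncomputable def jacksonWeight (c : ℕ → ℝ) (n N j : ℕ) : Polynomial ℝ :=
  ∑ l ∈ Finset.range n, ∑ m ∈ Finset.range n,
    Polynomial.C ((1 / N : ℝ) * (c l * c m * Real.cos (((l : ℝ) - m) * (2 * Real.pi * j / N)))) *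
      Polynomial.Chebyshev.T ℝ ((l : ℤ) - m)

/-- Averaging the kernel over `θ` and `-θ` makes it even in `θ`, hence a polynomial in `cos θ`.
Nonnegativity and the sum over nodes are inherited from `sqKernel`. -/
lemma jacksonWeight_eval_cos (c : ℕ → ℝ) (n N j : ℕ) (θ : ℝ) :
    (jacksonWeight c n N j).eval (Real.cos θ) = (1 / (2 * N)) *
      (sqKernel c n (2 * Real.pi * j / N + θ) + sqKernel c n (2 * Real.pi * j / N + -θ)) := by
  unfold jacksonWeight sqKernel
  rw [← Finset.sum_add_distrib, Finset.mul_sum, Polynomial.eval_finsetSum]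
  refine Finset.sum_congr rfl fun l _ => ?_
  rw [← Finset.sum_add_distrib, Finset.mul_sum, Polynomial.eval_finsetSum]
  refine Finset.sum_congr rfl fun m _ => ?_
  rw [Polynomial.eval_mul, Polynomial.eval_C, Polynomial.Chebyshev.T_real_cos]
  push_cast
  rw [mul_add _ _ θ, mul_add _ _ (-θ), Real.cos_add, Real.cos_add, mul_neg, Real.cos_neg,
    Real.sin_neg]
  rcases Nat.eq_zero_or_pos N with h | h
  · subst h; simp
  · field_simp; ring

lemma jacksonWeight_eval_nonneg (c : ℕ → ℝ) (n N j : ℕ) {x : ℝ} (hx : |x| ≤ 1) :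
    0 ≤ (jacksonWeight c n N j).eval x := by
  rw [abs_le] at hx
  rw [← Real.cos_arccos hx.1 hx.2, jacksonWeight_eval_cos]
  have := sqKernel_nonneg c n
  exact mul_nonneg (by positivity) (add_nonneg (this _) (this _))

lemma sum_jacksonWeight_eval (c : ℕ → ℝ) {n N : ℕ} (hnN : n ≤ N) (hN : 0 < N) {x : ℝ}
    (hx : |x| ≤ 1) :
    ∑ j ∈ Finset.range N, (jacksonWeight c n N j).eval x = ∑ l ∈ Finset.range n, c l ^ 2 := by
  rw [abs_le] at hx
  rw [← Real.cos_arccos hx.1 hx.2]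
  simp_rw [jacksonWeight_eval_cos]
  rw [← Finset.mul_sum, Finset.sum_add_distrib, sum_sqKernel_grid c hnN, sum_sqKernel_grid c hnN]
  field_simp; ring

lemma sq_cos_sub_cos_le (a b : ℝ) : (Real.cos a - Real.cos b) ^ 2 ≤ 2 * (1 - Real.cos (b + a)) ∧
    (Real.cos a - Real.cos b) ^ 2 ≤ 2 * (1 - Real.cos (b + -a)) := by
  have e1 : 1 - Real.cos (b + a) = 2 * Real.sin ((a + b) / 2) ^ 2 := by
    rw [show b + a = 2 * ((a + b) / 2) by ring, Real.cos_two_mul, Real.cos_sq']; ring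
  have e2 : 1 - Real.cos (b + -a) = 2 * Real.sin ((a - b) / 2) ^ 2 := by
    rw [show b + -a = -(2 * ((a - b) / 2)) by ring, Real.cos_neg, Real.cos_two_mul, Real.cos_sq']
    ring
  rw [e1, e2, Real.cos_sub_cos]
  have h1 := Real.sin_sq_le_one ((a + b) / 2)
  have h2 := Real.sin_sq_le_one ((a - b) / 2)
  constructor
  · nlinarith [mul_nonneg (sq_nonneg (Real.sin ((a + b) / 2))) (sub_nonneg.2 h2)]
  · nlinarith [mul_nonneg (sq_nonneg (Real.sin ((a - b) / 2))) (sub_nonneg.2 h1)]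

/-- The squared distance to a node is at most `|1 - e^{it}|²` at both shifted angles; this factor
turns the kernel into that of the differenced coefficients (`sqKernel_diff`), whose grid sum is
exact. -/
lemma sum_jacksonWeight_sq_le (c : ℕ → ℝ) {n N : ℕ} (hnN : n ≤ N) (hN : 0 < N)
    (h0 : c 0 = 0) (hn : c n = 0) {x : ℝ} (hx : |x| ≤ 1) :
    ∑ j ∈ Finset.range N, (jacksonWeight c n N j).eval x *
      (x - Real.cos (2 * Real.pi * j / N)) ^ 2 ≤
      ∑ l ∈ Finset.range n, (c (l + 1) - c l) ^ 2 := by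
  rw [abs_le] at hx
  rw [← Real.cos_arccos hx.1 hx.2]
  set θ := Real.arccos x
  have hb : ∀ j ∈ Finset.range N, (jacksonWeight c n N j).eval (Real.cos θ) *
      (Real.cos θ - Real.cos (2 * Real.pi * j / N)) ^ 2 ≤ (1 / (2 * N)) *
      (sqKernel (fun l => c (l + 1) - c l) n (2 * Real.pi * j / N + θ) +
        sqKernel (fun l => c (l + 1) - c l) n (2 * Real.pi * j / N + -θ)) := by
    intro j _
    rw [jacksonWeight_eval_cos, ← sqKernel_diff c n _ h0 hn, ← sqKernel_diff c n _ h0 hn,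
      mul_assoc]
    refine mul_le_mul_of_nonneg_left ?_ (by positivity)
    obtain ⟨h1, h2⟩ := sq_cos_sub_cos_le θ (2 * Real.pi * j / N)
    rw [add_mul, mul_comm, mul_comm (sqKernel c n (_ + -θ))]
    exact add_le_add (mul_le_mul_of_nonneg_right h1 (sqKernel_nonneg _ _ _))
      (mul_le_mul_of_nonneg_right h2 (sqKernel_nonneg _ _ _))
  refine (Finset.sum_le_sum hb).trans (le_of_eq ?_)
  rw [← Finset.mul_sum, Finset.sum_add_distrib, sum_sqKernel_grid _ hnN, sum_sqKernel_grid _ hnN]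
  field_simp; ring

lemma abs_eval_T_le (r : ℤ) {x : ℝ} (hx : 1 ≤ |x|) :
    |(Polynomial.Chebyshev.T ℝ r).eval x| ≤ (3 * |x|) ^ r.natAbs := by
  have key : ∀ n : ℕ, |(Polynomial.Chebyshev.T ℝ (n : ℤ)).eval x| ≤ (3 * |x|) ^ n ∧
      |(Polynomial.Chebyshev.T ℝ ((n + 1 : ℕ) : ℤ)).eval x| ≤ (3 * |x|) ^ (n + 1) := by
    intro n
    induction n with
    | zero => simp; linarith
    | succ n ih =>
      refine ⟨ih.2, ?_⟩
      have h := Polynomial.Chebyshev.T_add_two ℝ (n : ℤ)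
      have h' : ((n + 1 + 1 : ℕ) : ℤ) = (n : ℤ) + 2 := by push_cast; ring
      rw [h', h]
      have h2 := ih.2
      push_cast at h2
      simp only [Polynomial.eval_sub, Polynomial.eval_mul, Polynomial.eval_X,
        Polynomial.eval_ofNat]
      refine (abs_sub _ _).trans ?_
      rw [abs_mul, abs_mul, abs_two]
      have h3 := ih.1
      have hp : 0 < (3 * |x|) ^ n := by positivity
      rw [pow_succ (3 * |x|) n] at h2
      rw [pow_succ, pow_succ]
      have h4 : 2 * |x| * |(Polynomial.Chebyshev.T ℝ ((n : ℤ) + 1)).eval x| ≤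
          2 * |x| * ((3 * |x|) ^ n * (3 * |x|)) := by gcongr
      have h5 : (3 * |x|) ^ n * 1 ≤ (3 * |x|) ^ n * (|x| * |x|) := by
        gcongr; nlinarith
      nlinarith
  rcases Int.natAbs_eq r with h | h
  · have := (key r.natAbs).1
    rwa [← h] at this
  · have := (key r.natAbs).1
    rwa [← Polynomial.Chebyshev.T_neg, ← h] at this

lemma natDegree_T_le (r : ℤ) : (Polynomial.Chebyshev.T ℝ r).natDegree ≤ r.natAbs := by
  exact (Polynomial.Chebyshev.natDegree_T ℝ r).le

lemma natDegree_jacksonWeight_le (c : ℕ → ℝ) (n N j : ℕ) :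
    (jacksonWeight c n N j).natDegree ≤ n := by
  refine Polynomial.natDegree_sum_le_of_forall_le _ _ fun l hl => ?_
  refine Polynomial.natDegree_sum_le_of_forall_le _ _ fun m hm => ?_
  refine (Polynomial.natDegree_C_mul_le _ _).trans ((natDegree_T_le _).trans ?_)
  simp only [Finset.mem_range] at hl hm
  omega

/-- Growth outside `[-1, 1]`: bound every Chebyshev factor by `(3|x|)^n` and apply Cauchy–Schwarz to
the coefficients. -/
lemma sum_abs_jacksonWeight_le (c : ℕ → ℝ) (hc : ∀ l, 0 ≤ c l) {n N : ℕ} (hN : 0 < N) {x : ℝ}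
    (hx : 1 ≤ |x|) :
    ∑ j ∈ Finset.range N, |(jacksonWeight c n N j).eval x| ≤
      (n * ∑ l ∈ Finset.range n, c l ^ 2) * (3 * |x|) ^ n := by
  have hb : ∀ j ∈ Finset.range N, |(jacksonWeight c n N j).eval x| ≤
      (1 / N : ℝ) * ((∑ l ∈ Finset.range n, c l) ^ 2 * (3 * |x|) ^ n) := by
    intro j _
    unfold jacksonWeight
    rw [Polynomial.eval_finsetSum, sq, Finset.sum_mul_sum, Finset.sum_mul, Finset.mul_sum]
    refine (Finset.abs_sum_le_sum_abs _ _).trans (Finset.sum_le_sum fun l hl => ?_)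
    rw [Polynomial.eval_finsetSum, Finset.sum_mul, Finset.mul_sum]
    refine (Finset.abs_sum_le_sum_abs _ _).trans (Finset.sum_le_sum fun m hm => ?_)
    rw [Polynomial.eval_mul, Polynomial.eval_C, abs_mul, abs_mul, abs_mul, abs_mul,
      abs_of_nonneg (hc l), abs_of_nonneg (hc m), abs_of_nonneg (by positivity : (0:ℝ) ≤ 1 / N),
      mul_assoc]
    have hT : |(Polynomial.Chebyshev.T ℝ ((l : ℤ) - m)).eval x| ≤ (3 * |x|) ^ n := by
      refine (abs_eval_T_le _ hx).trans (pow_le_pow_right₀ (by linarith) ?_)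
      simp only [Finset.mem_range] at hl hm
      omega
    refine mul_le_mul_of_nonneg_left ?_ (by positivity)
    refine mul_le_mul ?_ hT (abs_nonneg _) (mul_nonneg (hc _) (hc _))
    exact mul_le_of_le_one_right (mul_nonneg (hc _) (hc _)) (Real.abs_cos_le_one _)
  refine (Finset.sum_le_sum hb).trans ?_
  rw [Finset.sum_const, Finset.card_range, nsmul_eq_mul, ← mul_assoc, mul_one_div_cancel
    (by positivity), one_mul]
  refine mul_le_mul_of_nonneg_right ?_ (by positivity)
  have := sq_sum_le_card_mul_sum_sq (s := Finset.range n) (f := c)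
  simpa using this

/-- The tent sequence `0, 1, …, p, …, 1, 0`. -/
def tent (p l : ℕ) : ℝ := ((min l (2 * p - l) : ℕ) : ℝ)

lemma sum_sq_tent_ge (p : ℕ) : (p : ℝ) ^ 3 / 3 ≤ ∑ l ∈ Finset.range (2 * p), tent p l ^ 2 := by
  rcases Nat.eq_zero_or_pos p with h | h
  · subst h; simp
  have hs : Finset.range (p + 1) ⊆ Finset.range (2 * p) :=
    Finset.range_subset_range.2 (by omega)
  refine le_trans ?_ (Finset.sum_le_sum_of_subset_of_nonneg hs fun _ _ _ => sq_nonneg _)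
  have h1 : ∀ l ∈ Finset.range (p + 1), tent p l ^ 2 = (l : ℝ) ^ 2 := by
    intro l hl
    simp only [Finset.mem_range] at hl
    unfold tent
    rw [min_eq_left (by omega)]
  rw [Finset.sum_congr rfl h1]
  clear hs h1 h
  induction p with
  | zero => simp
  | succ p ih =>
    rw [Finset.sum_range_succ]
    push_cast
    have : (0 : ℝ) ≤ p := by positivity
    nlinarith

lemma sum_sq_diff_tent_le (p : ℕ) :
    ∑ l ∈ Finset.range (2 * p), (tent p (l + 1) - tent p l) ^ 2 ≤ 2 * p := by
  have : ∀ l ∈ Finset.range (2 * p), (tent p (l + 1) - tent p l) ^ 2 ≤ (1 : ℝ) := by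
    intro l hl
    simp only [Finset.mem_range] at hl
    unfold tent
    rw [sq_le_one_iff_abs_le_one, abs_le]
    constructor
    · have : min l (2 * p - l) ≤ min (l + 1) (2 * p - (l + 1)) + 1 := by omega
      have : ((min l (2 * p - l) : ℕ) : ℝ) ≤ ((min (l + 1) (2 * p - (l + 1)) : ℕ) : ℝ) + 1 := by
        exact_mod_cast this
      linarith
    · have : min (l + 1) (2 * p - (l + 1)) ≤ min l (2 * p - l) + 1 := by omega
      have : ((min (l + 1) (2 * p - (l + 1)) : ℕ) : ℝ) ≤ ((min l (2 * p - l) : ℕ) : ℝ) + 1 := by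
        exact_mod_cast this
      linarith
  refine (Finset.sum_le_sum this).trans ?_
  simp

/-- A positive quadrature-type approximation scheme of Jackson order on `[-1, 1]`. -/
theorem exists_jackson_weights {p : ℕ} (hp : 0 < p) :
    ∃ (N : ℕ) (z : Fin N → ℝ) (w : Fin N → Polynomial ℝ),
      (∀ j, |z j| ≤ 1) ∧ (∀ j, (w j).natDegree ≤ 2 * p) ∧
      (∀ x, |x| ≤ 1 → ∀ j, 0 ≤ (w j).eval x) ∧
      (∀ x, |x| ≤ 1 → ∑ j, (w j).eval x = 1) ∧
      (∀ x, |x| ≤ 1 → ∑ j, (w j).eval x * (x - z j) ^ 2 ≤ 6 / (p : ℝ) ^ 2) ∧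
      (∀ x, 1 ≤ |x| → ∑ j, |(w j).eval x| ≤ (6 * |x|) ^ (2 * p)) := by
  have hp' : (0 : ℝ) < p := by exact_mod_cast hp
  set S := ∑ l ∈ Finset.range (2 * p), tent p l ^ 2 with hS
  have hSge := sum_sq_tent_ge p
  rw [← hS] at hSge
  have hSpos : 0 < S := lt_of_lt_of_le (by positivity) hSge
  -- The normalised tent makes the weights sum to `1`; its second moment is at most `2p / (p³/3) =
  -- 6/p²`.
  set c : ℕ → ℝ := fun l => tent p l / Real.sqrt S with hc
  have hc1 : ∑ l ∈ Finset.range (2 * p), c l ^ 2 = 1 := by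
    simp only [hc, div_pow, Real.sq_sqrt hSpos.le]
    rw [← Finset.sum_div, ← hS, div_self hSpos.ne']
  have hc2 : ∑ l ∈ Finset.range (2 * p), (c (l + 1) - c l) ^ 2 ≤ 6 / (p : ℝ) ^ 2 := by
    simp only [hc, ← sub_div, div_pow, Real.sq_sqrt hSpos.le]
    rw [← Finset.sum_div, div_le_div_iff₀ hSpos (by positivity)]
    have := sum_sq_diff_tent_le p
    nlinarith [mul_le_mul_of_nonneg_right this (sq_nonneg (p : ℝ))]
  have h2p : 0 < 2 * p := by omega
  refine ⟨2 * p, fun j => Real.cos (2 * Real.pi * (j : ℕ) / (2 * p : ℕ)),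
    fun j => jacksonWeight c (2 * p) (2 * p) j, fun j => Real.abs_cos_le_one _,
    fun j => natDegree_jacksonWeight_le _ _ _ _,
    fun x hx j => jacksonWeight_eval_nonneg _ _ _ _ hx, fun x hx => ?_, fun x hx => ?_,
    fun x hx => ?_⟩
  · rw [Fin.sum_univ_eq_sum_range (fun j => (jacksonWeight c (2 * p) (2 * p) j).eval x)]
    rw [sum_jacksonWeight_eval c le_rfl h2p hx, hc1]
  · rw [Fin.sum_univ_eq_sum_range (fun j => (jacksonWeight c (2 * p) (2 * p) j).eval x *
      (x - Real.cos (2 * Real.pi * j / (2 * p : ℕ))) ^ 2)]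
    refine (sum_jacksonWeight_sq_le c le_rfl h2p ?_ ?_ hx).trans hc2
    · simp [hc, tent]
    · simp [hc, tent]
  · rw [Fin.sum_univ_eq_sum_range (fun j => |(jacksonWeight c (2 * p) (2 * p) j).eval x|)]
    refine (sum_abs_jacksonWeight_le c (fun l => by simp only [hc, tent]; positivity) h2p hx).trans ?_
    -- The prefactor `2p ≤ 2^(2p)` turns the base `3|x|` into `6|x|`.
    rw [hc1, mul_one, show 6 * |x| = 2 * (3 * |x|) by ring, mul_pow 2 (3 * |x|)]
    refine mul_le_mul_of_nonneg_right ?_ (by positivity)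
    exact_mod_cast (Nat.lt_two_pow_self (n := 2 * p)).le

end JacksonKernel

/-! ### Functions given by polynomials of bounded total degree -/

section PolynomialFunctions

/-- `f` is given by a polynomial of total degree at most `n`. -/
def IsPolyFun {d : ℕ} (n : ℕ) (f : EuclideanSpace ℝ (Fin d) → ℝ) : Prop :=
  ∃ p : MvPolynomial (Fin d) ℝ, p.totalDegree ≤ n ∧ ∀ x, polyEval p x = f x

variable {d : ℕ} {n m : ℕ} {f g : EuclideanSpace ℝ (Fin d) → ℝ}

lemma IsPolyFun.mono (hf : IsPolyFun n f) (h : n ≤ m) : IsPolyFun m f := by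
  obtain ⟨p, hp, h'⟩ := hf
  exact ⟨p, hp.trans h, h'⟩

lemma isPolyFun_const (n : ℕ) (c : ℝ) :
    IsPolyFun n (fun _ : EuclideanSpace ℝ (Fin d) => c) :=
  ⟨MvPolynomial.C c, by simp, fun x => by simp [polyEval]⟩

lemma isPolyFun_coord (i : Fin d) : IsPolyFun 1 (fun x : EuclideanSpace ℝ (Fin d) => x i) :=
  ⟨MvPolynomial.X i, by simp, fun x => by simp [polyEval]⟩

lemma IsPolyFun.add (hf : IsPolyFun n f) (hg : IsPolyFun n g) :
    IsPolyFun n (fun x => f x + g x) := by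
  obtain ⟨p, hp, h⟩ := hf
  obtain ⟨q, hq, h'⟩ := hg
  refine ⟨p + q, (MvPolynomial.totalDegree_add _ _).trans (max_le hp hq), fun x => ?_⟩
  simp [polyEval, ← h, ← h']

lemma IsPolyFun.mul (hf : IsPolyFun n f) (hg : IsPolyFun m g) :
    IsPolyFun (n + m) (fun x => f x * g x) := by
  obtain ⟨p, hp, h⟩ := hf
  obtain ⟨q, hq, h'⟩ := hg
  refine ⟨p * q, (MvPolynomial.totalDegree_mul _ _).trans (add_le_add hp hq), fun x => ?_⟩
  simp [polyEval, ← h, ← h']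

lemma IsPolyFun.const_mul (hf : IsPolyFun n f) (c : ℝ) : IsPolyFun n (fun x => c * f x) := by
  simpa using (isPolyFun_const 0 c).mul hf

lemma IsPolyFun.sub (hf : IsPolyFun n f) (hg : IsPolyFun n g) :
    IsPolyFun n (fun x => f x - g x) := by
  simpa [sub_eq_add_neg] using hf.add (hg.const_mul (-1))

lemma IsPolyFun.pow (hf : IsPolyFun n f) (r : ℕ) : IsPolyFun (n * r) (fun x => f x ^ r) := by
  induction r with
  | zero => simpa using isPolyFun_const 0 (1 : ℝ)
  | succ r ih => simpa [pow_succ, Nat.mul_succ] using ih.mul hf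

lemma IsPolyFun.sum {ι : Type*} (s : Finset ι) {F : ι → EuclideanSpace ℝ (Fin d) → ℝ}
    (h : ∀ i ∈ s, IsPolyFun n (F i)) : IsPolyFun n (fun x => ∑ i ∈ s, F i x) := by
  classical
  induction s using Finset.induction_on with
  | empty => simpa using isPolyFun_const n (0 : ℝ)
  | insert a s ha ih =>
    simp_rw [Finset.sum_insert ha]
    exact (h a (by simp)).add (ih fun i hi => h i (by simp [hi]))

lemma IsPolyFun.prod {ι : Type*} (s : Finset ι) {F : ι → EuclideanSpace ℝ (Fin d) → ℝ}
    (h : ∀ i ∈ s, IsPolyFun n (F i)) : IsPolyFun (n * s.card) (fun x => ∏ i ∈ s, F i x) := by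
  classical
  induction s using Finset.induction_on with
  | empty => simpa using isPolyFun_const 0 (1 : ℝ)
  | insert a s ha ih =>
    simp_rw [Finset.prod_insert ha, Finset.card_insert_of_notMem ha, Nat.mul_succ,
      add_comm (n * s.card)]
    exact (h a (by simp)).mul (ih fun i hi => h i (by simp [hi]))

lemma IsPolyFun.eval (q : Polynomial ℝ) (hq : q.natDegree ≤ m) (hf : IsPolyFun 1 f) :
    IsPolyFun m (fun x => q.eval (f x)) := by
  simp_rw [Polynomial.eval_eq_sum_range]
  refine IsPolyFun.sum _ fun i hi => ?_
  refine ((hf.pow i).const_mul _).mono ?_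
  simp only [Finset.mem_range] at hi
  omega

end PolynomialFunctions

/-! ### Tensor product approximation on a cube -/

section TensorJackson

variable {k N : ℕ}

/-- The tensor product approximation operator on the cube `[-R, R]^k`. -/
noncomputable def tensorOp (z : Fin N → ℝ) (w : Fin N → Polynomial ℝ) (R : ℝ)
    (g : EuclideanSpace ℝ (Fin k) → ℝ) (y : EuclideanSpace ℝ (Fin k)) : ℝ :=
  ∑ j : Fin k → Fin N, g (WithLp.toLp 2 fun i => R * z (j i)) *
    ∏ i, (w (j i)).eval (y i / R)

lemma sum_prod_pi (f : Fin k → Fin N → ℝ) :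
    ∑ j : Fin k → Fin N, ∏ i, f i (j i) = ∏ i, ∑ a, f i a := by
  rw [Finset.prod_univ_sum, Fintype.piFinset_univ]

/-- Linearity of expectation under a product of weights of total mass one: the other coordinates sum
to `1`. -/
lemma sum_prod_mul_sum (f h : Fin k → Fin N → ℝ) (hf : ∀ i, ∑ a, f i a = 1) :
    ∑ j : Fin k → Fin N, (∏ i, f i (j i)) * ∑ i, h i (j i) = ∑ i, ∑ a, f i a * h i a := by
  simp_rw [Finset.mul_sum]
  rw [Finset.sum_comm]
  refine Finset.sum_congr rfl fun i0 _ => ?_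
  have h1 : ∀ j : Fin k → Fin N, (∏ i, f i (j i)) * h i0 (j i0) =
      ∏ i, (f i (j i) * if i = i0 then h i (j i) else 1) := by
    intro j
    rw [Finset.prod_mul_distrib]
    simp
  simp_rw [h1]
  rw [sum_prod_pi (fun i a => f i a * if i = i0 then h i a else 1), Finset.prod_eq_single i0]
  · simp
  · intro i _ hi
    simp [hi, hf]
  · simp

lemma isPolyFun_tensorOp_comp {d p : ℕ} (z : Fin N → ℝ) (w : Fin N → Polynomial ℝ)
    (hw : ∀ j, (w j).natDegree ≤ p) (R : ℝ) (g : EuclideanSpace ℝ (Fin k) → ℝ)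
    (Y : EuclideanSpace ℝ (Fin d) → EuclideanSpace ℝ (Fin k))
    (hY : ∀ i, IsPolyFun 1 (fun x => Y x i)) :
    IsPolyFun (p * k) (fun x => tensorOp z w R g (Y x)) := by
  unfold tensorOp
  refine IsPolyFun.sum _ fun j _ => IsPolyFun.const_mul ?_ _
  have := IsPolyFun.prod (n := p) (Finset.univ : Finset (Fin k))
    (F := fun i x => (w (j i)).eval (Y x i / R)) fun i _ => ?_
  · simpa using this
  · refine IsPolyFun.eval _ (hw _) ?_
    simpa [div_eq_inv_mul] using (hY i).const_mul R⁻¹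

/-- The weights form a probability distribution on grid points, whose mean squared distance to `y`
is at most `T²`; an `L`-Lipschitz function thus moves by at most `L T` on average. -/
lemma abs_tensorOp_sub_le {z : Fin N → ℝ} {w : Fin N → Polynomial ℝ} {R L T v : ℝ}
    (hw0 : ∀ x, |x| ≤ 1 → ∀ j, 0 ≤ (w j).eval x) (hw1 : ∀ x, |x| ≤ 1 → ∑ j, (w j).eval x = 1)
    (hw2 : ∀ x, |x| ≤ 1 → ∑ j, (w j).eval x * (x - z j) ^ 2 ≤ v)
    (hR : 0 < R) (hT : 0 < T) (hTv : k * (R ^ 2 * v) ≤ T ^ 2)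
    {g : EuclideanSpace ℝ (Fin k) → ℝ} (hL : 0 ≤ L) (hg : ∀ a b, |g a - g b| ≤ L * ‖a - b‖)
    {y : EuclideanSpace ℝ (Fin k)} (hy : ∀ i, |y i| ≤ R) :
    |tensorOp z w R g y - g y| ≤ L * T := by
  have hy' : ∀ i, |y i / R| ≤ 1 := fun i => by
    rw [abs_div, abs_of_pos hR, div_le_one hR]; exact hy i
  set W : (Fin k → Fin N) → ℝ := fun j => ∏ i, (w (j i)).eval (y i / R) with hW
  have hWnn : ∀ j, 0 ≤ W j := fun j => Finset.prod_nonneg fun i _ => hw0 _ (hy' i) _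
  have hWsum : ∑ j, W j = 1 := by
    rw [hW, sum_prod_pi (fun i a => (w a).eval (y i / R))]
    exact Finset.prod_eq_one fun i _ => hw1 _ (hy' i)
  have hWsq : ∑ j, W j * ‖(WithLp.toLp 2 fun i => R * z (j i)) - y‖ ^ 2 ≤ T ^ 2 := by
    have h1 : ∀ j : Fin k → Fin N, ‖(WithLp.toLp 2 fun i => R * z (j i)) - y‖ ^ 2 =
        ∑ i, R ^ 2 * (y i / R - z (j i)) ^ 2 := by
      intro j
      rw [EuclideanSpace.real_norm_sq_eq]
      refine Finset.sum_congr rfl fun i _ => ?_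
      simp only [PiLp.sub_apply]
      field_simp
      ring
    simp_rw [h1]
    rw [hW, sum_prod_mul_sum (fun i a => (w a).eval (y i / R))
      (fun i a => R ^ 2 * (y i / R - z a) ^ 2) fun i => hw1 _ (hy' i)]
    refine le_trans ?_ hTv
    have h2 : ∀ i ∈ (Finset.univ : Finset (Fin k)), ∑ a, (w a).eval (y i / R) *
        (R ^ 2 * (y i / R - z a) ^ 2) ≤ R ^ 2 * v := by
      intro i _
      have := mul_le_mul_of_nonneg_left (hw2 _ (hy' i)) (sq_nonneg R)
      rw [Finset.mul_sum] at this
      refine le_of_eq_of_le (Finset.sum_congr rfl fun a _ => ?_) this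
      ring
    refine (Finset.sum_le_sum h2).trans ?_
    simp
  have h3 : tensorOp z w R g y - g y =
      ∑ j, W j * (g (WithLp.toLp 2 fun i => R * z (j i)) - g y) := by
    simp_rw [mul_sub, Finset.sum_sub_distrib, ← Finset.sum_mul, hWsum, one_mul, tensorOp, hW,
      mul_comm]
  rw [h3]
  refine (Finset.abs_sum_le_sum_abs _ _).trans ?_
  have h4 : ∀ j ∈ (Finset.univ : Finset (Fin k → Fin N)),
      |W j * (g (WithLp.toLp 2 fun i => R * z (j i)) - g y)| ≤
      L / (2 * T) * (W j * ‖(WithLp.toLp 2 fun i => R * z (j i)) - y‖ ^ 2) + L * T / 2 * W j := by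
    intro j _
    rw [abs_mul, abs_of_nonneg (hWnn j)]
    have h5 := mul_le_mul_of_nonneg_left (hg (WithLp.toLp 2 fun i => R * z (j i)) y) (hWnn j)
    refine h5.trans ?_
    generalize ‖(WithLp.toLp 2 fun i => R * z (j i)) - y‖ = u
    -- The arithmetic–geometric mean inequality replaces Cauchy–Schwarz for passing from the second
    -- to the first moment.
    have h6 : u ≤ u ^ 2 / (2 * T) + T / 2 := by
      have : u ^ 2 / (2 * T) + T / 2 - u = (u - T) ^ 2 / (2 * T) := by field_simp; ring
      have h7 : 0 ≤ (u - T) ^ 2 / (2 * T) := by positivity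
      linarith
    have h8 := mul_le_mul_of_nonneg_left h6 (mul_nonneg (hWnn j) hL)
    calc W j * (L * u) = W j * L * u := by ring
      _ ≤ _ := h8
      _ = _ := by ring
  refine (Finset.sum_le_sum h4).trans ?_
  rw [Finset.sum_add_distrib, ← Finset.mul_sum, ← Finset.mul_sum, hWsum]
  have h9 : L / (2 * T) * ∑ j, W j * ‖(WithLp.toLp 2 fun i => R * z (j i)) - y‖ ^ 2 ≤
      L / (2 * T) * T ^ 2 := mul_le_mul_of_nonneg_left hWsq (by positivity)
  have h10 : L / (2 * T) * T ^ 2 = L * T / 2 := by field_simp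
  linarith

/-- With `M > 1` the largest `|y i| / R`, every coordinate contributes at most `(6M)^(2p)`, whether
it lies inside or outside the interval. The exponent is even, so the bound is a polynomial. -/
lemma abs_tensorOp_le_of_outside {z : Fin N → ℝ} {w : Fin N → Polynomial ℝ} {R : ℝ} {p : ℕ}
    (hw0 : ∀ x, |x| ≤ 1 → ∀ j, 0 ≤ (w j).eval x) (hw1 : ∀ x, |x| ≤ 1 → ∑ j, (w j).eval x = 1)
    (hw3 : ∀ x, 1 ≤ |x| → ∑ j, |(w j).eval x| ≤ (6 * |x|) ^ (2 * p))
    (hR : 0 < R) {g : EuclideanSpace ℝ (Fin k) → ℝ} (hg : ∀ a, |g a| ≤ 1)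
    {y : EuclideanSpace ℝ (Fin k)} (hy : ∃ i, R < |y i|) :
    |tensorOp z w R g y| ≤ ∑ i, (6 * (y i / R)) ^ (2 * p * k) ∧
      1 ≤ ∑ i, (6 * (y i / R)) ^ (2 * p * k) := by
  obtain ⟨i1, hi1⟩ := hy
  obtain ⟨i0, -, hi0⟩ := Finset.exists_max_image (Finset.univ : Finset (Fin k)) (fun i => |y i|)
    ⟨i1, Finset.mem_univ _⟩
  have hR0 : R < |y i0| := hi1.trans_le (hi0 i1 (Finset.mem_univ _))
  set M := |y i0| / R with hM
  have hM1 : 1 ≤ M := by rw [hM, one_le_div hR]; exact hR0.le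
  have hpow : ∀ i, (6 * (y i / R)) ^ (2 * p * k) = (6 * (|y i| / R)) ^ (2 * p * k) := by
    intro i
    rw [mul_assoc 2 p k, pow_mul, pow_mul _ 2]
    congr 1
    rw [mul_pow, mul_pow, div_pow, div_pow, sq_abs]
  have hMle : (6 * M) ^ (2 * p * k) ≤ ∑ i, (6 * (y i / R)) ^ (2 * p * k) := by
    simp_rw [hpow]
    exact Finset.single_le_sum (f := fun i => (6 * (|y i| / R)) ^ (2 * p * k))
      (fun i _ => by positivity) (Finset.mem_univ i0)
  refine ⟨le_trans ?_ hMle, le_trans (one_le_pow₀ (by linarith)) hMle⟩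
  unfold tensorOp
  refine (Finset.abs_sum_le_sum_abs _ _).trans ?_
  have h1 : ∀ j ∈ (Finset.univ : Finset (Fin k → Fin N)),
      |g (WithLp.toLp 2 fun i => R * z (j i)) * ∏ i, (w (j i)).eval (y i / R)| ≤
      ∏ i, |(w (j i)).eval (y i / R)| := by
    intro j _
    rw [abs_mul, Finset.abs_prod]
    exact mul_le_of_le_one_left (Finset.prod_nonneg fun _ _ => abs_nonneg _) (hg _)
  refine (Finset.sum_le_sum h1).trans ?_
  rw [sum_prod_pi (fun i a => |(w a).eval (y i / R)|), pow_mul]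
  have h2 : ∀ i ∈ (Finset.univ : Finset (Fin k)), ∑ a, |(w a).eval (y i / R)| ≤
      (6 * M) ^ (2 * p) := by
    intro i _
    have hle : |y i / R| ≤ M := by
      rw [abs_div, abs_of_pos hR]
      exact div_le_div_of_nonneg_right (hi0 i (Finset.mem_univ _)) hR.le
    rcases le_total 1 (|y i / R|) with h | h
    · refine (hw3 _ h).trans ?_
      gcongr
    · rw [Finset.sum_congr rfl fun a _ => abs_of_nonneg (hw0 _ h a), hw1 _ h]
      exact one_le_pow₀ (by linarith)
  refine (Finset.prod_le_prod (fun i _ => Finset.sum_nonneg fun _ _ => abs_nonneg _) h2).trans ?_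
  simp

end TensorJackson

/-! ### Gaussian measure of translates -/

section CameronMartin

lemma gaussianReal_withDensity_exp (a : ℝ) :
    (gaussianReal 0 1).withDensity (fun x => ENNReal.ofReal (Real.exp (a * x - a ^ 2 / 2))) =
      gaussianReal a 1 := by
  rw [gaussianReal_of_var_ne_zero _ one_ne_zero, gaussianReal_of_var_ne_zero _ one_ne_zero,
    ← withDensity_mul _ (measurable_gaussianPDF _ _) (by fun_prop)]
  congr 1
  ext x
  simp only [Pi.mul_apply, gaussianPDF]
  rw [← ENNReal.ofReal_mul (gaussianPDFReal_nonneg _ _ _)]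
  congr 1
  simp only [gaussianPDFReal]
  rw [mul_assoc, ← Real.exp_add]
  congr 2
  simp
  ring

lemma lintegral_pi_prod {k : ℕ} (μ : Fin k → Measure ℝ) [∀ i, IsProbabilityMeasure (μ i)]
    (f : Fin k → ℝ → ℝ≥0∞) (hf : ∀ i, Measurable (f i)) :
    ∫⁻ x, ∏ i, f i (x i) ∂(Measure.pi μ) = ∏ i, ∫⁻ x, f i x ∂(μ i) := by
  have hind : iIndepFun (fun i (x : Fin k → ℝ) => f i (x i)) (Measure.pi μ) :=
    iIndepFun_pi fun i => (hf i).aemeasurable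
  have h := lintegral_prod_eq_prod_lintegral_of_indepFun Finset.univ
    (fun i (x : Fin k → ℝ) => f i (x i)) hind fun i => (hf i).comp (measurable_pi_apply i)
  rw [h]
  refine Finset.prod_congr rfl fun i _ => ?_
  rw [← (measurePreserving_eval μ i).map_eq, lintegral_map (hf i) (measurable_pi_apply i)]

lemma pi_gaussianReal_withDensity_exp {k : ℕ} (a : Fin k → ℝ) :
    (Measure.pi fun _ : Fin k => gaussianReal 0 1).withDensity
      (fun x => ∏ i, ENNReal.ofReal (Real.exp (a i * x i - a i ^ 2 / 2))) =
      Measure.pi fun i => gaussianReal (a i) 1 := by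
  symm
  refine Measure.pi_eq fun s hs => ?_
  rw [withDensity_apply _ (MeasurableSet.univ_pi hs), ← lintegral_indicator
    (MeasurableSet.univ_pi hs)]
  have h1 : ∀ x : Fin k → ℝ, (Set.univ.pi s).indicator
      (fun x : Fin k → ℝ => ∏ i, ENNReal.ofReal (Real.exp (a i * x i - a i ^ 2 / 2))) x =
      ∏ i, (s i).indicator (fun t => ENNReal.ofReal (Real.exp (a i * t - a i ^ 2 / 2))) (x i) := by
    intro x
    by_cases hx : x ∈ Set.univ.pi s
    · rw [Set.indicator_of_mem hx]
      refine Finset.prod_congr rfl fun i _ => ?_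
      rw [Set.indicator_of_mem (hx i (Set.mem_univ i))]
    · rw [Set.indicator_of_notMem hx]
      simp only [Set.mem_pi, Set.mem_univ, true_implies, not_forall] at hx
      obtain ⟨i, hi⟩ := hx
      exact (Finset.prod_eq_zero (Finset.mem_univ i) (Set.indicator_of_notMem hi _)).symm
  simp_rw [h1]
  rw [lintegral_pi_prod (fun _ => gaussianReal 0 1)
    (fun i => (s i).indicator fun t => ENNReal.ofReal (Real.exp (a i * t - a i ^ 2 / 2)))
    fun i => Measurable.indicator (by fun_prop) (hs i)]
  refine Finset.prod_congr rfl fun i _ => ?_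
  rw [lintegral_indicator (hs i), ← withDensity_apply _ (hs i), gaussianReal_withDensity_exp]

lemma pi_gaussianReal_map_add {k : ℕ} (a : Fin k → ℝ) :
    (Measure.pi fun _ : Fin k => gaussianReal 0 1).map (fun x => x + a) =
      (Measure.pi fun _ : Fin k => gaussianReal 0 1).withDensity
      (fun x => ENNReal.ofReal (Real.exp (∑ i, a i * x i - (∑ i, a i ^ 2) / 2))) := by
  have h1 : (fun x : Fin k → ℝ => ENNReal.ofReal (Real.exp (∑ i, a i * x i - (∑ i, a i ^ 2) / 2))) =
      fun x => ∏ i, ENNReal.ofReal (Real.exp (a i * x i - a i ^ 2 / 2)) := by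
    ext x
    rw [← ENNReal.ofReal_prod_of_nonneg fun i _ => (Real.exp_pos _).le, ← Real.exp_sum,
      Finset.sum_sub_distrib, Finset.sum_div]
  rw [h1, pi_gaussianReal_withDensity_exp]
  have h2 := Measure.pi_map_pi (μ := fun _ : Fin k => gaussianReal 0 1)
    (f := fun i t => t + a i) (fun i => by fun_prop)
  simp_rw [gaussianReal_map_add_const, zero_add] at h2
  exact h2

/-- Averaging over opposite translates loses at most the Gaussian factor. -/
lemma stdGaussian_translates_ge {k : ℕ} {A : Set (EuclideanSpace ℝ (Fin k))}
    (hA : MeasurableSet A) (v : EuclideanSpace ℝ (Fin k)) :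
    2 * ENNReal.ofReal (Real.exp (-‖v‖ ^ 2 / 2)) * stdGaussian (EuclideanSpace ℝ (Fin k)) A ≤
      stdGaussian (EuclideanSpace ℝ (Fin k)) ((fun x => x + v) ⁻¹' A) +
      stdGaussian (EuclideanSpace ℝ (Fin k)) ((fun x => x + -v) ⁻¹' A) := by
  have hmeas : Measurable (WithLp.toLp 2 : (Fin k → ℝ) → EuclideanSpace ℝ (Fin k)) := by fun_prop
  set B : Set (Fin k → ℝ) := WithLp.toLp 2 ⁻¹' A with hB
  have hBm : MeasurableSet B := hmeas hA
  have key : ∀ u : EuclideanSpace ℝ (Fin k),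
      stdGaussian (EuclideanSpace ℝ (Fin k)) ((fun x => x + u) ⁻¹' A) =
      ∫⁻ x in B, ENNReal.ofReal (Real.exp (∑ i, u i * x i - (∑ i, u i ^ 2) / 2))
        ∂(Measure.pi fun _ : Fin k => gaussianReal 0 1) := by
    intro u
    rw [← withDensity_apply _ hBm, ← pi_gaussianReal_map_add (fun i => u i),
      Measure.map_apply (by fun_prop) hBm, ← map_pi_eq_stdGaussian,
      Measure.map_apply hmeas (by
        exact (by fun_prop : Measurable fun x : EuclideanSpace ℝ (Fin k) => x + u) hA)]
    congr 1
  rw [key, key, ← lintegral_add_left (by fun_prop), ← map_pi_eq_stdGaussian,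
    Measure.map_apply hmeas hA, ← hB]
  rw [← setLIntegral_const]
  have htwo : ∀ y : ℝ, 2 * ENNReal.ofReal y = ENNReal.ofReal (2 * y) := fun y => by
    rw [ENNReal.ofReal_mul (by norm_num)]; simp
  refine lintegral_mono fun x => ?_
  rw [EuclideanSpace.real_norm_sq_eq, ← ENNReal.ofReal_add (Real.exp_pos _).le (Real.exp_pos _).le,
    htwo]
  refine ENNReal.ofReal_le_ofReal ?_
  simp only [PiLp.neg_apply, neg_mul, Finset.sum_neg_distrib, neg_sq]
  generalize ∑ i, v i * x i = s
  generalize (∑ i, v i ^ 2) = q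
  rw [show s - q / 2 = s + -q / 2 by ring, show -s - q / 2 = -s + -q / 2 by ring,
    Real.exp_add, Real.exp_add, ← add_mul]
  refine mul_le_mul_of_nonneg_right ?_ (Real.exp_pos _).le
  -- The densities of the two opposite translates sum to `2 exp(-‖v‖²/2) cosh ⟨v, x⟩`.
  have := Real.one_le_cosh s
  rw [Real.cosh_eq] at this
  linarith

end CameronMartin

/-! ### Points leaving a convex set under a translation -/

section Crossing

variable {k : ℕ}

/-- The points of a convex set which leave it when translated by `v` have measure `O(‖v‖)`. -/
lemma stdGaussian_crossing_le {Q : Set (EuclideanSpace ℝ (Fin k))} (hQ : Convex ℝ Q)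
    (hQm : MeasurableSet Q) (v : EuclideanSpace ℝ (Fin k)) :
    stdGaussian (EuclideanSpace ℝ (Fin k)) {x | x ∈ Q ∧ x + v ∉ Q} ≤ ENNReal.ofReal (2 * ‖v‖) := by
  set γ := stdGaussian (EuclideanSpace ℝ (Fin k)) with hγ
  rcases eq_or_ne v 0 with rfl | hv
  · have : {x | x ∈ Q ∧ x + 0 ∉ Q} = ∅ := by ext x; simp
    rw [this]; simp
  have hvpos : 0 < ‖v‖ := norm_pos_iff.2 hv
  rcases le_or_gt 1 ‖v‖ with h1 | h1
  · refine prob_le_one.trans ?_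
    rw [← ENNReal.ofReal_one]
    exact ENNReal.ofReal_le_ofReal (by linarith)
  set A := {x | x ∈ Q ∧ x + v ∉ Q} with hA
  have hAm : MeasurableSet A := hQm.inter
    ((by fun_prop : Measurable fun x : EuclideanSpace ℝ (Fin k) => x + v) hQm.compl)
  -- If `x + a v` and `x + b v` lie in `Q` and `a + 1 ≤ b`, convexity puts `x + (a+1) v` in `Q`, so
  -- `x + a v` does not leave `Q`. Translates of `A` by distinct integer multiples of `v` are
  -- therefore disjoint.
  have hdis : ∀ (x : EuclideanSpace ℝ (Fin k)) (a b : ℝ), a + 1 ≤ b → x + a • v ∈ A →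
      x + b • v ∈ A → False := by
    intro x a b hab ha hb
    refine ha.2 ?_
    have := hQ ha.1 hb.1 (a := (b - a - 1) / (b - a)) (b := 1 / (b - a))
      (div_nonneg (by linarith) (by linarith)) (div_nonneg (by linarith) (by linarith))
      (by have : b - a ≠ 0 := by linarith
          field_simp; ring)
    convert this using 1
    have h2 : b - a ≠ 0 := by linarith
    have h3 : a + 1 = (b - a - 1) / (b - a) * a + 1 / (b - a) * b := by field_simp; ring
    have h4 : (b - a - 1) / (b - a) + 1 / (b - a) = 1 := by field_simp; ring
    calc x + a • v + v = (1 : ℝ) • x + (a + 1) • v := by module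
      _ = _ := by rw [h3, ← h4]; module
  -- About `1/‖v‖` pairs of opposite translates have length at most `1`. Each pair has measure at
  -- least `2 exp(-1/2) γ(A) ≥ γ(A)`, and disjointness gives `J γ(A) ≤ 1`.
  set J := ⌊1 / ‖v‖⌋₊ with hJ
  have hJle : (J : ℝ) * ‖v‖ ≤ 1 := by
    have := Nat.floor_le (by positivity : 0 ≤ 1 / ‖v‖)
    rwa [le_div_iff₀ hvpos] at this
  have hJlt : 1 < ((J : ℝ) + 1) * ‖v‖ := by
    have := Nat.lt_floor_add_one (1 / ‖v‖)
    rwa [div_lt_iff₀ hvpos] at this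
  have hJ1 : 1 ≤ J := by
    rw [hJ, Nat.le_floor_iff (by positivity), le_div_iff₀ hvpos]
    push_cast; linarith
  set P : ℕ → Set (EuclideanSpace ℝ (Fin k)) := fun j =>
    ((fun x => x + (((j : ℝ) + 1) • v)) ⁻¹' A) ∪ ((fun x => x + -(((j : ℝ) + 1) • v)) ⁻¹' A)
    with hP
  have hshm : ∀ u : EuclideanSpace ℝ (Fin k), MeasurableSet ((fun x => x + u) ⁻¹' A) := fun u =>
    (by fun_prop : Measurable fun x : EuclideanSpace ℝ (Fin k) => x + u) hAm
  have hPge : ∀ j ∈ Finset.range J, 2 * ENNReal.ofReal (Real.exp (-1 / 2)) * γ A ≤ γ (P j) := by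
    intro j hj
    simp only [Finset.mem_range] at hj
    rw [hP, measure_union _ (hshm _)]
    · refine le_trans ?_ (stdGaussian_translates_ge hAm _)
      gcongr
      rw [norm_smul, Real.norm_eq_abs, abs_of_nonneg (by positivity : (0:ℝ) ≤ (j : ℝ) + 1)]
      have h5 : ((j : ℝ) + 1) * ‖v‖ ≤ 1 := by
        refine le_trans ?_ hJle
        gcongr
        exact_mod_cast hj
      exact pow_le_one₀ (by positivity) h5
    · rw [Set.disjoint_left]
      intro x h5 h6
      rw [Set.mem_preimage, ← neg_smul] at h6
      exact hdis x (-((j : ℝ) + 1)) ((j : ℝ) + 1) (by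
        have : (0 : ℝ) ≤ j := by positivity
        linarith) h6 h5
  have hPdis : ∀ i j : ℕ, i < j → Disjoint (P i) (P j) := by
    intro i j hij
    have hij' : (i : ℝ) + 1 ≤ j := by exact_mod_cast hij
    have hi0 : (0 : ℝ) ≤ i := by positivity
    rw [Set.disjoint_left]
    rintro x (h5 | h5) (h6 | h6)
    · exact hdis x _ _ (by linarith) h5 h6
    · rw [Set.mem_preimage, ← neg_smul] at h6
      exact hdis x _ _ (by linarith) h6 h5
    · rw [Set.mem_preimage, ← neg_smul] at h5
      exact hdis x _ _ (by linarith) h5 h6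
    · rw [Set.mem_preimage, ← neg_smul] at h5 h6
      exact hdis x _ _ (by linarith) h6 h5
  have hsum : ∑ j ∈ Finset.range J, γ (P j) ≤ 1 := by
    rw [← measure_biUnion_finset _ fun j _ => (hshm _).union (hshm _)]
    · exact prob_le_one
    · intro i _ j _ hij
      rcases lt_or_gt_of_ne hij with h | h
      · exact hPdis i j h
      · exact (hPdis j i h).symm
  have hfin := (Finset.sum_le_sum hPge).trans hsum
  rw [Finset.sum_const, Finset.card_range, nsmul_eq_mul] at hfin
  have hAtop : γ A ≠ ∞ := measure_ne_top _ _
  rw [← ENNReal.ofReal_toReal hAtop] at hfin ⊢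
  refine ENNReal.ofReal_le_ofReal ?_
  have h7 : (J : ℝ) * (2 * Real.exp (-1 / 2) * (γ A).toReal) ≤ 1 := by
    have : ENNReal.ofReal ((J : ℝ) * (2 * Real.exp (-1 / 2) * (γ A).toReal)) ≤
        ENNReal.ofReal 1 := by
      rw [ENNReal.ofReal_mul (by positivity), ENNReal.ofReal_mul (by positivity),
        ENNReal.ofReal_mul (by positivity)]
      simpa using hfin
    exact (ENNReal.ofReal_le_ofReal_iff (by norm_num)).1 this
  have h8 : (1 : ℝ) / 2 ≤ Real.exp (-1 / 2) := by
    have := Real.add_one_le_exp (-1 / 2 : ℝ); linarith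
  have h9 : 0 ≤ (γ A).toReal := ENNReal.toReal_nonneg
  have h10 : (J : ℝ) * (γ A).toReal ≤ 1 := by
    have : (J : ℝ) * (2 * (1 / 2) * (γ A).toReal) ≤
        J * (2 * Real.exp (-1 / 2) * (γ A).toReal) := by gcongr
    linarith
  have hJ1' : (1 : ℝ) ≤ J := by exact_mod_cast hJ1
  have h11 : (1 : ℝ) ≤ 2 * J * ‖v‖ := by nlinarith
  have h12 : (γ A).toReal * 1 ≤ (γ A).toReal * (2 * J * ‖v‖) := by gcongr
  nlinarith

end Crossing

/-! ### Gaussian moment bounds -/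

section GaussianMoments

lemma lintegral_exp_sq_gaussianReal :
    ∫⁻ t, ENNReal.ofReal (Real.exp (t ^ 2 / 4)) ∂(gaussianReal 0 1) = ENNReal.ofReal (Real.sqrt 2) := by
  rw [gaussianReal_of_var_ne_zero _ one_ne_zero, lintegral_withDensity_eq_lintegral_mul _
    (measurable_gaussianPDF _ _) (by fun_prop)]
  have h : ∀ t : ℝ, (gaussianPDF 0 1 * fun t => ENNReal.ofReal (Real.exp (t ^ 2 / 4))) t =
      ENNReal.ofReal (Real.sqrt 2) * gaussianPDF 0 2 t := by
    intro t
    simp only [Pi.mul_apply, gaussianPDF]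
    rw [← ENNReal.ofReal_mul (gaussianPDFReal_nonneg _ _ _), ← ENNReal.ofReal_mul (by positivity)]
    congr 1
    simp only [gaussianPDFReal, sub_zero, NNReal.coe_one, mul_one, NNReal.coe_ofNat]
    rw [mul_assoc, ← Real.exp_add, Real.sqrt_mul (by positivity) 2, ← mul_assoc]
    congr 1
    · field_simp
    · congr 1; ring
  simp_rw [h]
  rw [lintegral_const_mul _ (measurable_gaussianPDF _ _), lintegral_gaussianPDF_eq_one _ two_ne_zero,
    mul_one]

/-- One term of the exponential series gives `t^(2M) ≤ 4^M M! exp(t²/4)`, and the Gaussian mean of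
`exp(t²/4)` is `√2 ≤ 2`. -/
lemma lintegral_even_pow_gaussianReal_le (M : ℕ) :
    ∫⁻ t, ENNReal.ofReal (t ^ (2 * M)) ∂(gaussianReal 0 1) ≤
      ENNReal.ofReal (2 * (4 ^ M * M.factorial)) := by
  have h : ∀ t : ℝ, ENNReal.ofReal (t ^ (2 * M)) ≤
      ENNReal.ofReal (4 ^ M * M.factorial) * ENNReal.ofReal (Real.exp (t ^ 2 / 4)) := by
    intro t
    rw [← ENNReal.ofReal_mul (by positivity)]
    refine ENNReal.ofReal_le_ofReal ?_
    have := Real.pow_div_factorial_le_exp (t ^ 2 / 4) (by positivity) M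
    rw [div_pow, div_div, div_le_iff₀ (by positivity)] at this
    rw [pow_mul]
    linarith
  refine (lintegral_mono h).trans ?_
  rw [lintegral_const_mul _ (by fun_prop), lintegral_exp_sq_gaussianReal,
    ← ENNReal.ofReal_mul (by positivity), mul_comm]
  refine ENNReal.ofReal_le_ofReal (mul_le_mul_of_nonneg_right ?_ (by positivity))
  rw [Real.sqrt_le_left (by norm_num)]
  norm_num

variable {k : ℕ}

lemma stdGaussian_map_coord (i : Fin k) :
    (stdGaussian (EuclideanSpace ℝ (Fin k))).map (fun x => x i) = gaussianReal 0 1 := by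
  rw [← map_pi_eq_stdGaussian, Measure.map_map (by fun_prop) (by fun_prop)]
  exact (measurePreserving_eval (fun _ : Fin k => gaussianReal 0 1) i).map_eq

lemma lintegral_norm_stdGaussian_le :
    ∫⁻ x, ENNReal.ofReal ‖x‖ ∂(stdGaussian (EuclideanSpace ℝ (Fin k))) ≤
      ENNReal.ofReal (5 * Real.sqrt k) := by
  rcases Nat.eq_zero_or_pos k with rfl | hk
  · simp [Subsingleton.elim _ (0 : EuclideanSpace ℝ (Fin 0))]
  have hs : 0 < Real.sqrt k := Real.sqrt_pos.2 (by exact_mod_cast hk)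
  have hs2 : Real.sqrt k * Real.sqrt k = k := Real.mul_self_sqrt (by positivity)
  have h1 : ∀ x : EuclideanSpace ℝ (Fin k), ENNReal.ofReal ‖x‖ ≤
      ENNReal.ofReal (1 / (2 * Real.sqrt k)) * (∑ i, ENNReal.ofReal (x i ^ (2 * 1))) +
      ENNReal.ofReal (Real.sqrt k / 2) := by
    intro x
    rw [← ENNReal.ofReal_sum_of_nonneg (fun i _ => (even_two_mul 1).pow_nonneg _),
      ← ENNReal.ofReal_mul (by positivity), mul_one, ← EuclideanSpace.real_norm_sq_eq,
      ← ENNReal.ofReal_add (by positivity) (by positivity)]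
    refine ENNReal.ofReal_le_ofReal ?_
    have : 1 / (2 * Real.sqrt k) * ‖x‖ ^ 2 + Real.sqrt k / 2 - ‖x‖ =
        (‖x‖ - Real.sqrt k) ^ 2 / (2 * Real.sqrt k) := by field_simp; ring
    have h7 : 0 ≤ (‖x‖ - Real.sqrt k) ^ 2 / (2 * Real.sqrt k) := by positivity
    linarith
  have hc : ∀ i : Fin k, ∫⁻ x, ENNReal.ofReal (x i ^ (2 * 1))
      ∂(stdGaussian (EuclideanSpace ℝ (Fin k))) ≤ ENNReal.ofReal 8 := by
    intro i
    have := lintegral_even_pow_gaussianReal_le 1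
    rw [← stdGaussian_map_coord i, lintegral_map (by fun_prop) (by fun_prop)] at this
    refine this.trans (ENNReal.ofReal_le_ofReal ?_)
    norm_num
  refine (lintegral_mono h1).trans ?_
  rw [lintegral_add_right _ measurable_const, lintegral_const_mul _ (by fun_prop),
    lintegral_finsetSum _ (fun i _ => by fun_prop), lintegral_const, measure_univ,
    mul_one (ENNReal.ofReal (Real.sqrt k / 2))]
  have h2 : ∑ i : Fin k, ∫⁻ x, ENNReal.ofReal (x i ^ (2 * 1))
      ∂(stdGaussian (EuclideanSpace ℝ (Fin k))) ≤ ENNReal.ofReal (8 * k) := by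
    refine (Finset.sum_le_sum fun i _ => hc i).trans ?_
    rw [Finset.sum_const, Finset.card_univ, Fintype.card_fin, nsmul_eq_mul, mul_comm 8,
      ENNReal.ofReal_mul (by positivity)]
    simp
  refine (add_le_add_left (mul_le_mul_right h2 _) _).trans ?_
  rw [← ENNReal.ofReal_mul (by positivity), ← ENNReal.ofReal_add (by positivity) (by positivity)]
  refine ENNReal.ofReal_le_ofReal (le_of_lt ?_)
  have : 1 / (2 * Real.sqrt k) * (8 * k) = 4 * Real.sqrt k := by
    rw [div_mul_eq_mul_div, div_eq_iff (by positivity)]; linear_combination (-8) * hs2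
  rw [this]; linarith

end GaussianMoments

/-! ### Gaussian measure of the boundary layer of a convex set -/

section ConvexBoundary

variable {k : ℕ}

/-- Supporting functional at a point outside a finite-dimensional convex set. -/
lemma Convex.exists_support_functional {K : Set (EuclideanSpace ℝ (Fin k))} (hK : Convex ℝ K)
    (hne : K.Nonempty) {y : EuclideanSpace ℝ (Fin k)} (hy : y ∉ K) :
    ∃ L : StrongDual ℝ (EuclideanSpace ℝ (Fin k)), ‖L‖ = 1 ∧ ∀ a ∈ K, L a ≤ L y := by
  have key : ∃ L : StrongDual ℝ (EuclideanSpace ℝ (Fin k)), L ≠ 0 ∧ ∀ a ∈ K, L a ≤ L y := by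
    by_cases hint : (interior K).Nonempty
    · exact geometric_hahn_banach_of_nonempty_interior_point hK (fun h => hy (interior_subset h)) hint
    · rw [hK.interior_nonempty_iff_affineSpan_eq_top,
        AffineSubspace.affineSpan_eq_top_iff_vectorSpan_eq_top_of_nonempty ℝ _ _ hne] at hint
      obtain ⟨f, hf0, hf⟩ := Submodule.exists_le_ker_of_lt_top _ (lt_top_iff_ne_top.2 hint)
      obtain ⟨a0, ha0⟩ := hne
      have hconst : ∀ a ∈ K, f a = f a0 := by
        intro a ha
        have := hf (vsub_mem_vectorSpan ℝ ha ha0)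
        rw [LinearMap.mem_ker, vsub_eq_sub, map_sub, sub_eq_zero] at this
        exact this
      set L := LinearMap.toContinuousLinearMap f with hL
      have hLf : ∀ x, L x = f x := fun x => rfl
      have hL0 : L ≠ 0 := by
        intro h
        apply hf0
        ext x
        rw [← hLf, h]; simp
      rcases le_total (f a0) (f y) with h | h
      · exact ⟨L, hL0, fun a ha => by rw [hLf, hLf, hconst a ha]; exact h⟩
      · refine ⟨-L, neg_ne_zero.2 hL0, fun a ha => ?_⟩
        rw [neg_apply, neg_apply, hLf, hLf, hconst a ha]
        linarith
  obtain ⟨L, hL0, hL⟩ := key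
  have hn : 0 < ‖L‖ := norm_pos_iff.2 hL0
  refine ⟨‖L‖⁻¹ • L, ?_, fun a ha => ?_⟩
  · rw [norm_smul, norm_inv, norm_norm, inv_mul_cancel₀ hn.ne']
  · simp only [smul_apply, smul_eq_mul]
    exact mul_le_mul_of_nonneg_left (hL a ha) (by positivity)

/-- The points at distance less than `δ` from both `K` and its complement. -/
def boundaryLayer (K : Set (EuclideanSpace ℝ (Fin k))) (δ : ℝ) :
    Set (EuclideanSpace ℝ (Fin k)) :=
  {x | Metric.infDist x K < δ ∧ Metric.infDist x Kᶜ < δ}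

lemma measurableSet_boundaryLayer (K : Set (EuclideanSpace ℝ (Fin k))) (δ : ℝ) :
    MeasurableSet (boundaryLayer K δ) :=
  ((isOpen_lt (Metric.continuous_infDist_pt K) continuous_const).inter
    (isOpen_lt (Metric.continuous_infDist_pt Kᶜ) continuous_const)).measurableSet

/-- Support `K` at a point `y ∉ K` within `δ` of `x`. Then `L ≤ L y < L x + δ` on `K`, so `L < L x +
2δ` on the thickening, and a step raising `L` by `2δ` leaves it. -/
lemma exists_exit_functional {K : Set (EuclideanSpace ℝ (Fin k))} (hK : Convex ℝ K)
    (hne : K.Nonempty) (hne' : Kᶜ.Nonempty) {δ : ℝ} {x : EuclideanSpace ℝ (Fin k)}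
    (hx : x ∈ boundaryLayer K δ) :
    ∃ L : StrongDual ℝ (EuclideanSpace ℝ (Fin k)), ‖L‖ = 1 ∧
      ∀ v, 2 * δ ≤ L v → x + v ∉ Metric.thickening δ K := by
  obtain ⟨y, hy, hxy⟩ := (Metric.infDist_lt_iff hne').1 hx.2
  obtain ⟨L, hL1, hL⟩ := hK.exists_support_functional hne hy
  refine ⟨L, hL1, fun v hv hmem => ?_⟩
  obtain ⟨a, ha, hxa⟩ := Metric.mem_thickening_iff.1 hmem
  have hLle : ∀ u, L u ≤ ‖u‖ := fun u => (le_abs_self _).trans (by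
    have := L.le_opNorm u
    rwa [hL1, one_mul] at this)
  have h1 := hLle (x + v - a)
  have h2 := hLle (y - x)
  rw [← dist_eq_norm] at h1 h2
  rw [dist_comm] at h2
  rw [map_sub, map_add] at h1
  rw [map_sub] at h2
  have h3 := hL a ha
  linarith

lemma stdGaussian_map_dual (L : StrongDual ℝ (EuclideanSpace ℝ (Fin k))) (hL : ‖L‖ = 1) :
    (stdGaussian (EuclideanSpace ℝ (Fin k))).map L = gaussianReal 0 1 := by
  rw [IsGaussian.map_eq_gaussianReal L, integral_strongDual_stdGaussian, variance_dual_stdGaussian,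
    hL]
  simp

lemma gaussianReal_Ici_one_pos : 0 < gaussianReal 0 1 (Set.Ici 1) := by
  rw [pos_iff_ne_zero]
  intro h
  have := gaussianReal_absolutelyContinuous' 0 one_ne_zero h
  simp at this

/-- The Gaussian measure of the `δ`-neighbourhood of the boundary of a convex set in `ℝ^k` is
`O(√k δ)`. -/
theorem exists_stdGaussian_boundaryLayer_le : ∃ C : ℝ, 0 < C ∧ ∀ (k : ℕ)
    (K : Set (EuclideanSpace ℝ (Fin k))) (δ : ℝ), Convex ℝ K → K.Nonempty → Kᶜ.Nonempty → 0 < δ →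
    stdGaussian (EuclideanSpace ℝ (Fin k)) (boundaryLayer K δ) ≤
      ENNReal.ofReal (C * Real.sqrt k * δ) := by
  set c := (gaussianReal 0 1 (Set.Ici 1)).toReal with hc
  have hctop : gaussianReal 0 1 (Set.Ici 1) ≠ ∞ := measure_ne_top _ _
  have hcpos : 0 < c := ENNReal.toReal_pos gaussianReal_Ici_one_pos.ne' hctop
  have hcof : gaussianReal 0 1 (Set.Ici 1) = ENNReal.ofReal c := (ENNReal.ofReal_toReal hctop).symm
  refine ⟨20 / c, by positivity, fun k K δ hK hne hne' hδ => ?_⟩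
  set γ := stdGaussian (EuclideanSpace ℝ (Fin k)) with hγ
  set Q := Metric.thickening δ K with hQdef
  have hQ : Convex ℝ Q := hK.thickening δ
  have hQm : MeasurableSet Q := Metric.isOpen_thickening.measurableSet
  -- Pairs (point, direction) for which the step `2δ v` leaves the thickening. Fixing `v`, the
  -- crossing bound and `E‖v‖ ≤ 5√k` bound the measure of `S` above; fixing `x` in the layer, the
  -- directions with `L v ≥ 1`, of probability `c`, bound it below.
  set S : Set (EuclideanSpace ℝ (Fin k) × EuclideanSpace ℝ (Fin k)) :=
    {q | q.1 ∈ Q ∧ q.1 + (2 * δ) • q.2 ∉ Q} with hS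
  have hSm : MeasurableSet S := (measurable_fst hQm).inter
    ((by fun_prop : Measurable fun q : EuclideanSpace ℝ (Fin k) × EuclideanSpace ℝ (Fin k) =>
      q.1 + (2 * δ) • q.2) hQm.compl)
  have hupper : (γ.prod γ) S ≤ ENNReal.ofReal (20 * Real.sqrt k * δ) := by
    rw [Measure.prod_apply_symm hSm]
    have h1 : ∀ v, γ ((fun x => (x, v)) ⁻¹' S) ≤ ENNReal.ofReal (4 * δ) * ENNReal.ofReal ‖v‖ := by
      intro v
      refine (stdGaussian_crossing_le hQ hQm ((2 * δ) • v)).trans (le_of_eq ?_)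
      rw [← ENNReal.ofReal_mul (by positivity), norm_smul, Real.norm_eq_abs,
        abs_of_pos (by positivity : 0 < 2 * δ)]
      congr 1; ring
    refine (lintegral_mono h1).trans ?_
    rw [lintegral_const_mul _ (by fun_prop)]
    refine (mul_le_mul_right lintegral_norm_stdGaussian_le _).trans (le_of_eq ?_)
    rw [← ENNReal.ofReal_mul (by positivity)]
    congr 1; ring
  have hlower : ENNReal.ofReal c * γ (boundaryLayer K δ) ≤ (γ.prod γ) S := by
    rw [Measure.prod_apply hSm, ← lintegral_indicator_const (measurableSet_boundaryLayer K δ)]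
    refine lintegral_mono fun x => ?_
    by_cases hx : x ∈ boundaryLayer K δ
    · rw [Set.indicator_of_mem hx]
      obtain ⟨L, hL1, hL⟩ := exists_exit_functional hK hne hne' hx
      rw [← hcof, ← stdGaussian_map_dual L hL1, Measure.map_apply (by fun_prop) measurableSet_Ici]
      refine measure_mono fun v hv => ⟨?_, hL _ ?_⟩
      · exact (Metric.mem_thickening_iff_infDist_lt hne).2 hx.1
      · simp only [Set.mem_preimage, Set.mem_Ici] at hv
        rw [map_smul, smul_eq_mul]
        nlinarith
    · rw [Set.indicator_of_notMem hx]; exact zero_le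
  have h := hlower.trans hupper
  rw [show 20 * Real.sqrt k * δ = c * (20 / c * Real.sqrt k * δ) by field_simp,
    ENNReal.ofReal_mul hcpos.le] at h
  exact (ENNReal.mul_le_mul_iff_right (by simpa using hcpos) ENNReal.ofReal_ne_top).1 h

end ConvexBoundary

/-! ### Lipschitz majorant and minorant -/

section LipschitzSandwich

variable {k : ℕ}

/-- A `2/δ`-Lipschitz function equal to `1` on `A` and to `-1` at distance at least `δ` from `A`. -/
noncomputable def cutoff (A : Set (EuclideanSpace ℝ (Fin k))) (δ : ℝ)
    (y : EuclideanSpace ℝ (Fin k)) : ℝ :=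
  1 - 2 * min 1 (Metric.infDist y A / δ)

variable {A K : Set (EuclideanSpace ℝ (Fin k))} {δ : ℝ}

lemma abs_cutoff_le_one (hδ : 0 < δ) (y : EuclideanSpace ℝ (Fin k)) : |cutoff A δ y| ≤ 1 := by
  have h0 : 0 ≤ min 1 (Metric.infDist y A / δ) :=
    le_min zero_le_one (div_nonneg Metric.infDist_nonneg hδ.le)
  have h1 := min_le_left 1 (Metric.infDist y A / δ)
  rw [abs_le]
  unfold cutoff
  constructor <;> linarith

lemma cutoff_of_mem {y : EuclideanSpace ℝ (Fin k)} (hy : y ∈ A) : cutoff A δ y = 1 := by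
  simp [cutoff, Metric.infDist_zero_of_mem hy]

lemma cutoff_of_le_infDist (hδ : 0 < δ) {y : EuclideanSpace ℝ (Fin k)}
    (hy : δ ≤ Metric.infDist y A) : cutoff A δ y = -1 := by
  unfold cutoff
  rw [min_eq_left ((one_le_div hδ).2 hy)]; norm_num

lemma abs_cutoff_sub_le (hδ : 0 < δ) (a b : EuclideanSpace ℝ (Fin k)) :
    |cutoff A δ a - cutoff A δ b| ≤ 2 / δ * ‖a - b‖ := by
  have h1 : |Metric.infDist a A - Metric.infDist b A| ≤ ‖a - b‖ := by
    have := (Metric.lipschitz_infDist_pt A).dist_le_mul a b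
    simpa [Real.dist_eq, dist_eq_norm] using this
  have h2 : |min 1 (Metric.infDist b A / δ) - min 1 (Metric.infDist a A / δ)| ≤
      |Metric.infDist b A / δ - Metric.infDist a A / δ| := by
    have := abs_min_sub_min_le_max 1 (Metric.infDist b A / δ) 1 (Metric.infDist a A / δ)
    simpa using this
  rw [← sub_div, abs_div, abs_of_pos hδ, abs_sub_comm (Metric.infDist b A)] at h2
  have h3 : cutoff A δ a - cutoff A δ b =
      2 * (min 1 (Metric.infDist b A / δ) - min 1 (Metric.infDist a A / δ)) := by
    unfold cutoff; ring
  rw [h3, abs_mul, abs_two, div_mul_eq_mul_div, mul_div_assoc]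
  exact mul_le_mul_of_nonneg_left (h2.trans (by gcongr)) (by norm_num)

/-- This sum is the gap between the majorant `cutoff K δ` and the minorant `-cutoff Kᶜ δ`. Off the
layer one summand is `-1` and the other at most `1`. -/
lemma cutoff_add_cutoff_compl_le (hδ : 0 < δ) (y : EuclideanSpace ℝ (Fin k)) :
    cutoff K δ y + cutoff Kᶜ δ y ≤ (boundaryLayer K δ).indicator (fun _ => 2) y := by
  have h1 := (abs_le.1 (abs_cutoff_le_one (A := K) hδ y)).2
  have h2 := (abs_le.1 (abs_cutoff_le_one (A := Kᶜ) hδ y)).2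
  by_cases hy : y ∈ boundaryLayer K δ
  · rw [Set.indicator_of_mem hy]; linarith
  · rw [Set.indicator_of_notMem hy]
    simp only [boundaryLayer, Set.mem_ofPred_eq, not_and_or, not_lt] at hy
    rcases hy with h | h
    · rw [cutoff_of_le_infDist hδ h]; linarith
    · rw [cutoff_of_le_infDist hδ h]; linarith

end LipschitzSandwich

/-! ### From Lipschitz to polynomial sandwiching -/

section PolynomialSandwich

variable {k : ℕ}

/-- The even power sum dominating polynomials outside the cube `[-R, R]^k`. -/
noncomputable def tailSum (R : ℝ) (n : ℕ) (y : EuclideanSpace ℝ (Fin k)) : ℝ :=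
  ∑ i, (6 * (y i / R)) ^ (2 * n)

lemma tailSum_nonneg (R : ℝ) (n : ℕ) (y : EuclideanSpace ℝ (Fin k)) : 0 ≤ tailSum R n y :=
  Finset.sum_nonneg fun _ _ => (even_two_mul n).pow_nonneg _

lemma isPolyFun_tailSum_comp {d : ℕ} (R : ℝ) (n : ℕ)
    (Y : EuclideanSpace ℝ (Fin d) → EuclideanSpace ℝ (Fin k))
    (hY : ∀ i, IsPolyFun 1 (fun x => Y x i)) :
    IsPolyFun (2 * n) (fun x => tailSum R n (Y x)) := by
  refine IsPolyFun.sum _ fun i _ => ?_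
  have := (((hY i).const_mul R⁻¹).const_mul 6).pow (2 * n)
  simpa [div_eq_inv_mul] using this

/-- Pointwise polynomial sandwiching of the indicator of a set with error controlled by the
boundary layer, a uniform error `e`, and a tail term. -/
theorem exists_poly_sandwich {F : EuclideanSpace ℝ (Fin k) → ℝ} (hF : IsConcept F) {δ R T : ℝ}
    {p : ℕ} (hδ : 0 < δ) (hR : 0 < R) (hT : 0 < T) (hp : 0 < p)
    (hTp : k * (R ^ 2 * (6 / (p : ℝ) ^ 2)) ≤ T ^ 2) :
    ∃ U D : EuclideanSpace ℝ (Fin k) → ℝ,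
      (∀ (d : ℕ) (Y : EuclideanSpace ℝ (Fin d) → EuclideanSpace ℝ (Fin k)),
        (∀ i, IsPolyFun 1 (fun x => Y x i)) →
        IsPolyFun (2 * (p * k)) (fun x => U (Y x)) ∧ IsPolyFun (2 * (p * k)) (fun x => D (Y x))) ∧
      (∀ y, D y ≤ F y ∧ F y ≤ U y) ∧
      ∀ y, |U y - D y| ≤ (boundaryLayer {y | F y = 1} δ).indicator (fun _ => 2) y +
        4 * (2 / δ * T) + 6 * tailSum R (p * k) y := by
  obtain ⟨N, z, w, -, hdeg, hw0, hw1, hw2, hw3⟩ := exists_jackson_weights hp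
  set K := {y | F y = 1} with hK
  have hL : 0 ≤ 2 / δ := by positivity
  set e := 2 / δ * T with he
  have he0 : 0 ≤ e := by positivity
  set P := tensorOp z w R (cutoff K δ) with hP
  set M := tensorOp z w R (cutoff Kᶜ δ) with hM
  have hin : ∀ y, (∀ i, |y i| ≤ R) →
      |P y - cutoff K δ y| ≤ e ∧ |M y - cutoff Kᶜ δ y| ≤ e := fun y hy =>
    ⟨abs_tensorOp_sub_le hw0 hw1 hw2 hR hT hTp hL (abs_cutoff_sub_le hδ) hy,
      abs_tensorOp_sub_le hw0 hw1 hw2 hR hT hTp hL (abs_cutoff_sub_le hδ) hy⟩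
  have hout : ∀ y, (¬ ∀ i, |y i| ≤ R) → |P y| ≤ tailSum R (p * k) y ∧
      |M y| ≤ tailSum R (p * k) y ∧ 1 ≤ tailSum R (p * k) y := fun y hy => by
    simp only [not_forall, not_le] at hy
    have h1 := abs_tensorOp_le_of_outside (z := z) hw0 hw1 hw3 hR (abs_cutoff_le_one (A := K) hδ) hy
    have h2 := abs_tensorOp_le_of_outside (z := z) hw0 hw1 hw3 hR (abs_cutoff_le_one (A := Kᶜ) hδ) hy
    rw [mul_assoc] at h1 h2
    exact ⟨h1.1, h2.1, h1.2⟩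
  have hFabs : ∀ y, -1 ≤ F y ∧ F y ≤ 1 := fun y => by
    rcases hF y with h | h <;> rw [h] <;> norm_num
  have hFup : ∀ y, F y ≤ cutoff K δ y := fun y => by
    rcases hF y with h | h
    · rw [cutoff_of_mem (A := K) h]; exact h.le
    · rw [h]; exact (abs_le.1 (abs_cutoff_le_one hδ y)).1
  have hFdn : ∀ y, -cutoff Kᶜ δ y ≤ F y := fun y => by
    rcases hF y with h | h
    · rw [h]; linarith [(abs_le.1 (abs_cutoff_le_one (A := Kᶜ) hδ y)).1]
    · rw [cutoff_of_mem (A := Kᶜ) (by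
        intro h'
        have : F y = 1 := h'
        rw [h] at this; norm_num at this), h]
  -- In the cube, the shift `e` pays for the approximation error. Outside, one tail sum dominates
  -- the approximant and another dominates `|F| ≤ 1`.
  have hsand : ∀ y, -M y - e - 2 * tailSum R (p * k) y ≤ F y ∧
      F y ≤ P y + e + 2 * tailSum R (p * k) y := by
    intro y
    have hq := tailSum_nonneg R (p * k) y
    by_cases hy : ∀ i, |y i| ≤ R
    · obtain ⟨h1, h2⟩ := hin y hy
      rw [abs_le] at h1 h2
      have := hFup y
      have := hFdn y
      constructor <;> linarith
    · obtain ⟨h1, h2, h3⟩ := hout y hy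
      rw [abs_le] at h1 h2
      have := hFabs y
      constructor <;> linarith
  refine ⟨fun y => P y + e + 2 * tailSum R (p * k) y, fun y => -M y - e - 2 * tailSum R (p * k) y,
    fun d Y hY => ?_, hsand, fun y => ?_⟩
  · have hT' := (isPolyFun_tailSum_comp R (p * k) Y hY).const_mul 2
    have hPp : ∀ g, IsPolyFun (2 * (p * k)) fun x => tensorOp z w R g (Y x) := fun g => by
      rw [← mul_assoc]; exact isPolyFun_tensorOp_comp z w hdeg R g Y hY
    refine ⟨((hPp _).add (isPolyFun_const _ e)).add hT', ?_⟩
    simpa using (((hPp (cutoff Kᶜ δ)).const_mul (-1)).sub (isPolyFun_const _ e)).sub hT'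
  · have hs := hsand y
    rw [abs_of_nonneg (by linarith)]
    have hq := tailSum_nonneg R (p * k) y
    have hcut := cutoff_add_cutoff_compl_le (K := K) hδ y
    have hind : 0 ≤ (boundaryLayer K δ).indicator (fun _ => (2 : ℝ)) y :=
      Set.indicator_nonneg (fun _ _ => by norm_num) _
    by_cases hy : ∀ i, |y i| ≤ R
    · obtain ⟨h1, h2⟩ := hin y hy
      rw [abs_le] at h1 h2
      linarith
    · obtain ⟨h1, h2, h3⟩ := hout y hy
      rw [abs_le] at h1 h2
      linarith

end PolynomialSandwich

/-! ### `L^s` norms of the error terms -/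

section Norms

variable {k : ℕ}

/-- With `M = nS`, the moment of order `2M` is at most `2 (4M)^M`; the constant `288` makes `(36/R²)
· 4M = 1/2`. -/
lemma eLpNorm_even_pow_gaussianReal_le {n S : ℕ} (hS : 0 < S) {R : ℝ} (hR : R ^ 2 = 288 * (n * S))
    (hR0 : 0 < R) :
    eLpNorm (fun t : ℝ => (6 * (t / R)) ^ (2 * n)) (S : ℝ≥0∞) (gaussianReal 0 1) ≤
      ENNReal.ofReal (2 * (1 / 2) ^ n) := by
  have hS' : (S : ℝ≥0∞) ≠ 0 := by exact_mod_cast hS.ne'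
  rw [eLpNorm_eq_lintegral_rpow_enorm_toReal hS' (by simp), ENNReal.toReal_natCast]
  have hSr : (0 : ℝ) < S := by exact_mod_cast hS
  rw [one_div, ENNReal.rpow_inv_le_iff hSr, ENNReal.rpow_natCast,
    ← ENNReal.ofReal_pow (by positivity)]
  have h1 : ∀ t : ℝ, ‖(6 * (t / R)) ^ (2 * n)‖ₑ ^ (S : ℝ) =
      ENNReal.ofReal ((36 / R ^ 2) ^ (n * S)) * ENNReal.ofReal (t ^ (2 * (n * S))) := by
    intro t
    rw [ENNReal.rpow_natCast, Real.enorm_eq_ofReal ((even_two_mul n).pow_nonneg _),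
      ← ENNReal.ofReal_pow ((even_two_mul n).pow_nonneg _), ← ENNReal.ofReal_mul (by positivity)]
    congr 1
    rw [← pow_mul, mul_assoc, pow_mul, pow_mul t, ← mul_pow]
    congr 1
    field_simp
    ring
  simp_rw [h1]
  rw [lintegral_const_mul _ (by fun_prop)]
  refine (mul_le_mul_right (lintegral_even_pow_gaussianReal_le (n * S)) _).trans ?_
  rw [← ENNReal.ofReal_mul (by positivity)]
  refine ENNReal.ofReal_le_ofReal ?_
  have hfac : ((n * S).factorial : ℝ) ≤ ((n * S : ℕ) : ℝ) ^ (n * S) := by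
    exact_mod_cast Nat.factorial_le_pow (n * S)
  have hnS : (0 : ℝ) < n * S := by
    have : 0 < R ^ 2 := by positivity
    linarith
  calc (36 / R ^ 2) ^ (n * S) * (2 * (4 ^ (n * S) * ((n * S).factorial : ℝ)))
      ≤ (36 / R ^ 2) ^ (n * S) * (2 * (4 ^ (n * S) * ((n * S : ℕ) : ℝ) ^ (n * S))) := by gcongr
    _ = 2 * (36 / R ^ 2 * 4 * ((n * S : ℕ) : ℝ)) ^ (n * S) := by rw [mul_pow, mul_pow]; ring
    _ = 2 * (1 / 2) ^ (n * S) := by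
        congr 2
        rw [hR, Nat.cast_mul, mul_assoc, div_mul_eq_mul_div, div_eq_iff (by positivity)]; ring
    _ ≤ 2 ^ S * (1 / 2) ^ (n * S) := by
        gcongr
        exact le_self_pow₀ (by norm_num) hS.ne'
    _ = (2 * (1 / 2) ^ n) ^ S := by rw [mul_pow, ← pow_mul]

lemma measurable_tailSum (R : ℝ) (n : ℕ) :
    Measurable (tailSum R n : EuclideanSpace ℝ (Fin k) → ℝ) := by
  unfold tailSum; fun_prop

lemma eLpNorm_tailSum_le {n : ℕ} {s R : ℝ} (hs : 1 ≤ s) (hR : R ^ 2 = 288 * (n * ⌈s⌉₊))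
    (hR0 : 0 < R) :
    eLpNorm (tailSum R n) (ENNReal.ofReal s) (stdGaussian (EuclideanSpace ℝ (Fin k))) ≤
      ENNReal.ofReal (k * (2 * (1 / 2) ^ n)) := by
  have hS : 0 < ⌈s⌉₊ := Nat.ceil_pos.2 (by linarith)
  have hs1 : (1 : ℝ≥0∞) ≤ ENNReal.ofReal s := by
    rw [← ENNReal.ofReal_one]; exact ENNReal.ofReal_le_ofReal hs
  have hsS : ENNReal.ofReal s ≤ (⌈s⌉₊ : ℝ≥0∞) := by
    rw [← ENNReal.ofReal_natCast]; exact ENNReal.ofReal_le_ofReal (Nat.le_ceil s)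
  have h1 : (tailSum R n : EuclideanSpace ℝ (Fin k) → ℝ) =
      ∑ i, fun y : EuclideanSpace ℝ (Fin k) => (6 * (y i / R)) ^ (2 * n) := by
    ext y; simp [tailSum]
  have hm : Measurable fun t : ℝ => (6 * (t / R)) ^ (2 * n) := by fun_prop
  have h2 : ∀ i ∈ (Finset.univ : Finset (Fin k)),
      eLpNorm (fun y : EuclideanSpace ℝ (Fin k) => (6 * (y i / R)) ^ (2 * n)) (ENNReal.ofReal s)
        (stdGaussian (EuclideanSpace ℝ (Fin k))) ≤ ENNReal.ofReal (2 * (1 / 2) ^ n) := by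
    intro i _
    refine (eLpNorm_le_eLpNorm_of_exponent_le hsS (by fun_prop)).trans ?_
    have := eLpNorm_even_pow_gaussianReal_le hS hR hR0
    rwa [← stdGaussian_map_coord i, eLpNorm_map_measure hm.aestronglyMeasurable (by fun_prop)]
      at this
  rw [h1]
  refine (eLpNorm_sum_le (fun i _ => by fun_prop) hs1).trans ((Finset.sum_le_sum h2).trans ?_)
  rw [Finset.sum_const, Finset.card_univ, Fintype.card_fin, nsmul_eq_mul,
    ENNReal.ofReal_mul (Nat.cast_nonneg k), ENNReal.ofReal_natCast]

lemma eLpNorm_sandwich_gap_le {B : Set (EuclideanSpace ℝ (Fin k))} (hB : MeasurableSet B)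
    {n : ℕ} {s R a b : ℝ} (hs : 1 ≤ s) (hR : R ^ 2 = 288 * (n * ⌈s⌉₊)) (hR0 : 0 < R)
    (ha : 0 ≤ a) (hb : 0 ≤ b)
    (hBm : stdGaussian (EuclideanSpace ℝ (Fin k)) B ≤ ENNReal.ofReal b) :
    eLpNorm (fun y => B.indicator (fun _ => (2 : ℝ)) y + a + 6 * tailSum R n y)
      (ENNReal.ofReal s) (stdGaussian (EuclideanSpace ℝ (Fin k))) ≤
      ENNReal.ofReal (2 * b ^ (1 / s) + a + 6 * (k * (2 * (1 / 2) ^ n))) := by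
  set γ := stdGaussian (EuclideanSpace ℝ (Fin k))
  have hs0 : 0 < s := by linarith
  have hs1 : (1 : ℝ≥0∞) ≤ ENNReal.ofReal s := by
    rw [← ENNReal.ofReal_one]; exact ENNReal.ofReal_le_ofReal hs
  have hsne : ENNReal.ofReal s ≠ 0 := (zero_lt_one.trans_le hs1).ne'
  have hm1 : AEStronglyMeasurable (B.indicator fun _ => (2 : ℝ)) γ :=
    (measurable_const.indicator hB).aestronglyMeasurable
  have hm3 : AEStronglyMeasurable (fun y => 6 * tailSum R n y) γ :=
    ((measurable_tailSum R n).const_mul 6).aestronglyMeasurable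
  have h1 := eLpNorm_add_le (hm1.add (aestronglyMeasurable_const (b := a))) hm3 hs1
  have h2 := eLpNorm_add_le hm1 (aestronglyMeasurable_const (b := a)) hs1
  have h3 : eLpNorm (B.indicator fun _ => (2 : ℝ)) (ENNReal.ofReal s) γ ≤
      ENNReal.ofReal (2 * b ^ (1 / s)) := by
    rw [eLpNorm_indicator_const hB hsne ENNReal.ofReal_ne_top, ENNReal.toReal_ofReal hs0.le,
      ENNReal.ofReal_mul (by norm_num), ← ENNReal.ofReal_rpow_of_nonneg hb (by positivity)]
    gcongr
    rw [Real.enorm_eq_ofReal (by norm_num)]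
  have h4 : eLpNorm (fun _ : EuclideanSpace ℝ (Fin k) => a) (ENNReal.ofReal s) γ =
      ENNReal.ofReal a := by
    rw [eLpNorm_const _ hsne (NeZero.ne γ), measure_univ, ENNReal.one_rpow, mul_one,
      Real.enorm_eq_ofReal ha]
  have h5 : eLpNorm (fun y => 6 * tailSum R n y) (ENNReal.ofReal s) γ ≤
      ENNReal.ofReal (6 * (k * (2 * (1 / 2) ^ n))) := by
    have := eLpNorm_const_smul (6 : ℝ) (tailSum R n) (ENNReal.ofReal s) γ
    simp only [Pi.smul_def, smul_eq_mul] at this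
    rw [this, ENNReal.ofReal_mul (by norm_num), Real.enorm_eq_ofReal (by norm_num)]
    gcongr
    exact eLpNorm_tailSum_le hs hR hR0
  rw [ENNReal.ofReal_add (by positivity) (by positivity), ENNReal.ofReal_add (by positivity) ha]
  refine h1.trans (add_le_add (h2.trans (add_le_add h3 h4.le)) h5)

end Norms

/-! ### Reduction to the intrinsic dimension -/

section Projection

variable {d k : ℕ}

/-- The linear map `x ↦ W x` between Euclidean spaces. -/
def mulVecEuclidean (W : Matrix (Fin k) (Fin d) ℝ) (x : EuclideanSpace ℝ (Fin d)) :
    EuclideanSpace ℝ (Fin k) :=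
  WithLp.toLp 2 (W.mulVec fun i => x i)

lemma measurable_mulVecEuclidean (W : Matrix (Fin k) (Fin d) ℝ) :
    Measurable (mulVecEuclidean W) := by
  unfold mulVecEuclidean Matrix.mulVec dotProduct
  fun_prop

lemma isPolyFun_mulVecEuclidean (W : Matrix (Fin k) (Fin d) ℝ) (i : Fin k) :
    IsPolyFun 1 (fun x => mulVecEuclidean W x i) := by
  change IsPolyFun 1 fun x => ∑ j, W i j * x j
  exact IsPolyFun.sum _ fun j _ => (isPolyFun_coord j).const_mul (W i j)

lemma mulVecEuclidean_transpose {W : Matrix (Fin k) (Fin d) ℝ} (hW : W * W.transpose = 1)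
    (y : EuclideanSpace ℝ (Fin k)) : mulVecEuclidean W (mulVecEuclidean W.transpose y) = y := by
  ext i
  simp [mulVecEuclidean, hW]

lemma inner_mulVecEuclidean (W : Matrix (Fin k) (Fin d) ℝ) (x : EuclideanSpace ℝ (Fin d))
    (y : EuclideanSpace ℝ (Fin k)) :
    inner ℝ (mulVecEuclidean W x) y = inner ℝ x (mulVecEuclidean W.transpose y) := by
  simp only [PiLp.inner_apply, mulVecEuclidean, Matrix.mulVec, dotProduct, Matrix.transpose_apply,
    RCLike.inner_apply, conj_trivial, Finset.mul_sum, Finset.sum_mul]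
  rw [Finset.sum_comm]
  refine Finset.sum_congr rfl fun i _ => Finset.sum_congr rfl fun j _ => ?_
  ring

lemma norm_mulVecEuclidean_transpose {W : Matrix (Fin k) (Fin d) ℝ} (hW : W * W.transpose = 1)
    (y : EuclideanSpace ℝ (Fin k)) : ‖mulVecEuclidean W.transpose y‖ = ‖y‖ := by
  have h := inner_mulVecEuclidean W (mulVecEuclidean W.transpose y) y
  rw [mulVecEuclidean_transpose hW, real_inner_self_eq_norm_sq, real_inner_self_eq_norm_sq] at h
  exact ((sq_eq_sq₀ (norm_nonneg _) (norm_nonneg _)).1 h).symm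

/-- The Gaussian characteristic function depends only on the norm, and `Wᵀ` is an isometry. -/
lemma stdGaussian_map_mulVecEuclidean {W : Matrix (Fin k) (Fin d) ℝ} (hW : W * W.transpose = 1) :
    (stdGaussian (EuclideanSpace ℝ (Fin d))).map (mulVecEuclidean W) =
      stdGaussian (EuclideanSpace ℝ (Fin k)) := by
  have := Measure.isProbabilityMeasure_map (μ := stdGaussian (EuclideanSpace ℝ (Fin d)))
    (measurable_mulVecEuclidean W).aemeasurable
  apply Measure.ext_of_charFun
  ext t
  rw [charFun_stdGaussian, charFun_apply, integral_map (measurable_mulVecEuclidean W).aemeasurable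
    (by fun_prop)]
  simp_rw [inner_mulVecEuclidean]
  rw [← charFun_apply, charFun_stdGaussian, norm_mulVecEuclidean_transpose hW]

lemma convex_of_comp_mulVecEuclidean {W : Matrix (Fin k) (Fin d) ℝ} (hW : W * W.transpose = 1)
    {f : EuclideanSpace ℝ (Fin d) → ℝ} {F : EuclideanSpace ℝ (Fin k) → ℝ}
    (hf : Convex ℝ {x | f x = 1}) (hfF : ∀ x, f x = F (mulVecEuclidean W x)) :
    Convex ℝ {y | F y = 1} := by
  have hadd : ∀ (a b : ℝ) (y z : EuclideanSpace ℝ (Fin k)), mulVecEuclidean W.transpose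
      (a • y + b • z) = a • mulVecEuclidean W.transpose y + b • mulVecEuclidean W.transpose z := by
    intro a b y z
    ext i
    simp only [mulVecEuclidean, Matrix.mulVec, dotProduct, PiLp.add_apply, PiLp.smul_apply,
      smul_eq_mul, Finset.mul_sum, ← Finset.sum_add_distrib]
    exact Finset.sum_congr rfl fun j _ => by ring
  have hmem : ∀ y, F y = 1 ↔ mulVecEuclidean W.transpose y ∈ {x | f x = 1} := by
    intro y
    change _ ↔ f (mulVecEuclidean W.transpose y) = 1
    rw [hfF, mulVecEuclidean_transpose hW]
  intro y hy z hz a b ha hb hab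
  change F _ = 1
  rw [hmem, hadd]
  exact hf ((hmem y).1 hy) ((hmem z).1 hz) ha hb hab

end Projection

/-! ### Choice of parameters and degree count -/

section Assembly

variable {d k : ℕ}

lemma hasSandwichingPolynomials_of_const {f : EuclideanSpace ℝ (Fin d) → ℝ} {c : ℝ}
    (hf : ∀ x, f x = c) (μ : Measure (EuclideanSpace ℝ (Fin d))) (ε s : ℝ) (ℓ : ℕ) :
    HasSandwichingPolynomials f μ ε s ℓ := by
  refine ⟨MvPolynomial.C c, MvPolynomial.C c, by simp, by simp, fun x => ?_, ?_⟩
  · simp [polyEval, hf x]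
  · simp

/-- Bernoulli gives `(1 - 1/(2s))^s ≥ 1/2`. Giving the layer measure `e^s/2` instead of `e^s` thus
frees `e/s` of the budget `ε = 2e` for the other errors. -/
lemma half_rpow_root_le {e s : ℝ} (he : 0 < e) (hs : 1 ≤ s) :
    2 * (e ^ s / 2) ^ (1 / s) ≤ 2 * e - e / s := by
  have hs0 : 0 < s := by linarith
  have h1 : 1 / (2 * s) ≤ 1 / 2 := by
    apply one_div_le_one_div_of_le <;> linarith
  have h2 := one_add_mul_self_le_rpow_one_add (s := -(1 / (2 * s))) (by linarith) hs
  have h3 : 1 + s * -(1 / (2 * s)) = 1 / 2 := by field_simp; norm_num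
  rw [h3] at h2
  have h4 : 0 ≤ 1 + -(1 / (2 * s)) := by linarith
  have h5 : (e ^ s / 2) ^ (1 / s) ≤ e * (1 + -(1 / (2 * s))) := by
    have : e ^ s / 2 ≤ (e * (1 + -(1 / (2 * s)))) ^ s := by
      rw [Real.mul_rpow he.le h4, div_eq_mul_one_div]
      exact mul_le_mul_of_nonneg_left h2 (by positivity)
    refine (Real.rpow_le_rpow (by positivity) this (by positivity)).trans (le_of_eq ?_)
    rw [← Real.rpow_mul (mul_nonneg he.le h4), mul_one_div_cancel hs0.ne', Real.rpow_one]
  have h6 : e * (1 + -(1 / (2 * s))) = e - e / s / 2 := by field_simp; ring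
  linarith

theorem exists_hasSandwichingPolynomials : ∃ A : ℝ, 1 ≤ A ∧
    ∀ (d k : ℕ) (ε s : ℝ), 0 < k → 0 < ε → ε < 1 → 1 ≤ s → ∀ f ∈ convexConcepts d k,
      HasSandwichingPolynomials f (stdGaussian (EuclideanSpace ℝ (Fin d))) ε s
        (2 * (⌈A * ((k : ℝ) ^ 3 * s ^ 3 / ((ε / 2) ^ (s + 1)) ^ 2)⌉₊ * k)) := by
  obtain ⟨C, hC, hbd⟩ := exists_stdGaussian_boundaryLayer_le
  -- The summand `24` serves the tail term, and `3538944 = 2 · 1728 · 1024` serves the cube error in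
  -- `hTp`.
  refine ⟨24 + 3538944 * C ^ 2, by nlinarith [sq_nonneg C], ?_⟩
  rintro d k ε s hk hε hε1 hs f ⟨-, hconv, F, W, hF, hW, hfF⟩
  have hfF' : ∀ x, f x = F (mulVecEuclidean W x) := hfF
  have hKconv := convex_of_comp_mulVecEuclidean hW hconv hfF'
  -- If `K` or its complement is empty, `f` is constant. These cases must be split off:
  -- `Metric.infDist` to the empty set is `0`, so the layer would be the whole space.
  by_cases hne : {y | F y = 1}.Nonempty
  swap
  · refine hasSandwichingPolynomials_of_const (c := -1) (fun x => ?_) _ _ _ _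
    rw [hfF']
    exact (hF _).resolve_left fun h => hne ⟨_, h⟩
  by_cases hne' : {y | F y = 1}ᶜ.Nonempty
  swap
  · refine hasSandwichingPolynomials_of_const (c := 1) (fun x => ?_) _ _ _ _
    rw [hfF']
    by_contra h
    exact hne' ⟨_, h⟩
  obtain ⟨e, rfl⟩ : ∃ e, ε = 2 * e := ⟨ε / 2, by ring⟩
  have he0 : 0 < e := by linarith
  have he1 : e < 1 := by linarith
  rw [mul_div_cancel_left₀ e two_ne_zero]
  have hs0 : 0 < s := by linarith
  have hk1 : (1 : ℝ) ≤ k := by exact_mod_cast hk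
  have hk0 : (0 : ℝ) < k := by linarith
  set b := e ^ s with hb
  have hbpos : 0 < b := Real.rpow_pos_of_pos he0 _
  have hb1 : b ≤ 1 := Real.rpow_le_one he0.le he1.le hs0.le
  have hB0 : e ^ (s + 1) = b * e := by rw [Real.rpow_add he0, Real.rpow_one]
  rw [hB0]
  set p := ⌈(24 + 3538944 * C ^ 2) * ((k : ℝ) ^ 3 * s ^ 3 / (b * e) ^ 2)⌉₊ with hp
  have hppos : 0 < p := Nat.ceil_pos.2 (by positivity)
  have hp0 : (0 : ℝ) < p := by exact_mod_cast hppos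
  have hple : (24 + 3538944 * C ^ 2) * ((k : ℝ) ^ 3 * s ^ 3) ≤ p * (b * e) ^ 2 := by
    have := Nat.le_ceil ((24 + 3538944 * C ^ 2) * ((k : ℝ) ^ 3 * s ^ 3 / (b * e) ^ 2))
    rw [← hp, ← mul_div_assoc, div_le_iff₀ (by positivity)] at this
    exact this
  set S := ⌈s⌉₊ with hS
  have hS0 : (0 : ℝ) < S := by exact_mod_cast Nat.ceil_pos.2 hs0
  have hS2 : (S : ℝ) ≤ 2 * s := by
    have := Nat.ceil_lt_add_one hs0.le
    linarith
  have hsk : 0 < Real.sqrt k := Real.sqrt_pos.2 hk0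
  have hsk2 : Real.sqrt k ^ 2 = k := Real.sq_sqrt hk0.le
  -- The layer gets measure at most `b/2`. The choices of `T` and `p` make the cube error and the
  -- tail at most `e/(2s)` each, which exhausts the slack.
  set δ := b / (2 * C * Real.sqrt k) with hδ
  have hδ0 : 0 < δ := by positivity
  set T := e * δ / (16 * s) with hT
  have hT0 : 0 < T := by positivity
  set R := Real.sqrt (288 * (((p * k : ℕ) : ℝ) * S)) with hR
  have hpk0 : (0 : ℝ) < ((p * k : ℕ) : ℝ) := by push_cast; positivity
  have hR0 : 0 < R := Real.sqrt_pos.2 (by positivity)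
  have hR2 : R ^ 2 = 288 * (((p * k : ℕ) : ℝ) * S) := Real.sq_sqrt (by positivity)
  -- As `R²` grows linearly in `p`, the left side decays only like `1/p`; this accounts for the
  -- square in the degree bound.
  have hTp : k * (R ^ 2 * (6 / (p : ℝ) ^ 2)) ≤ T ^ 2 := by
    have e1 : k * (R ^ 2 * (6 / (p : ℝ) ^ 2)) = 1728 * k ^ 2 * S / p := by
      rw [hR2]; push_cast; field_simp; norm_num
    have e2 : T ^ 2 = (b * e) ^ 2 / (1024 * C ^ 2 * k * s ^ 2) := by
      rw [hT, hδ, div_pow, mul_pow e, div_pow, mul_pow, mul_pow, hsk2]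
      field_simp; norm_num
    rw [e1, e2, div_le_div_iff₀ hp0 (by positivity)]
    have e3 : 1728 * (k : ℝ) ^ 2 * S * (1024 * C ^ 2 * k * s ^ 2) ≤
        1728 * (k : ℝ) ^ 2 * (2 * s) * (1024 * C ^ 2 * k * s ^ 2) := by gcongr
    have e4 : 0 ≤ 24 * ((k : ℝ) ^ 3 * s ^ 3) := by positivity
    nlinarith
  obtain ⟨U, D, hpoly, hsand, hgap⟩ := exists_poly_sandwich hF hδ0 hR0 hT0 hppos hTp
  obtain ⟨⟨pU, hpU, hpU'⟩, ⟨pD, hpD, hpD'⟩⟩ :=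
    hpoly d (mulVecEuclidean W) (isPolyFun_mulVecEuclidean W)
  refine ⟨pU, pD, hpU, hpD, fun x => ?_, ?_⟩
  · rw [hpU', hpD', hfF']
    exact hsand _
  have hBm := hbd k _ δ hKconv hne hne' hδ0
  have hδb : C * Real.sqrt k * δ = b / 2 := by rw [hδ]; field_simp
  rw [hδb] at hBm
  set G : EuclideanSpace ℝ (Fin k) → ℝ := fun y =>
    (boundaryLayer {y | F y = 1} δ).indicator (fun _ => 2) y + 4 * (2 / δ * T) +
      6 * tailSum R (p * k) y with hG
  have hBmeas := measurableSet_boundaryLayer {y | F y = 1} δ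
  have hGm : Measurable G :=
    ((measurable_const.indicator hBmeas).add_const _).add ((measurable_tailSum R _).const_mul 6)
  have hnorm := eLpNorm_sandwich_gap_le hBmeas hs hR2 hR0 (a := 4 * (2 / δ * T)) (by positivity)
    (by positivity) hBm
  rw [← stdGaussian_map_mulVecEuclidean hW, eLpNorm_map_measure hGm.aestronglyMeasurable
    (measurable_mulVecEuclidean W).aemeasurable] at hnorm
  refine (eLpNorm_mono_real (g := G ∘ mulVecEuclidean W) fun x => ?_).trans (hnorm.trans ?_)
  · rw [hpU', hpD', Real.norm_eq_abs]
    exact hgap _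
  refine ENNReal.ofReal_le_ofReal ?_
  have t1 := half_rpow_root_le he0 hs
  have t2 : 4 * (2 / δ * T) = e / s / 2 := by rw [hT]; field_simp; norm_num
  have t3 : 6 * (k * (2 * (1 / 2 : ℝ) ^ (p * k))) ≤ e / s / 2 := by
    have u1 : (p : ℝ) ≤ 2 ^ (p * k) := by
      have : p ≤ 2 ^ (p * k) :=
        (Nat.le_mul_of_pos_right p hk).trans (Nat.lt_two_pow_self (n := p * k)).le
      exact_mod_cast this
    have u2 : (b * e) ^ 2 ≤ e := by
      have v1 : b * e ≤ e := mul_le_of_le_one_left he0.le hb1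
      have v2 : 0 < b * e := by positivity
      nlinarith
    have u3 : 24 * ((k : ℝ) ^ 3 * s ^ 3) ≤ p * e := by
      have v1 : 0 ≤ 3538944 * C ^ 2 * ((k : ℝ) ^ 3 * s ^ 3) := by positivity
      have v2 : p * (b * e) ^ 2 ≤ p * e := by gcongr
      linarith
    have u4 : (k : ℝ) * s ≤ k ^ 3 * s ^ 3 := by
      rw [← mul_pow]
      exact le_self_pow₀ (one_le_mul_of_one_le_of_one_le hk1 hs) (by norm_num)
    have u5 : 24 * (k * s) ≤ (2 : ℝ) ^ (p * k) * e := by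
      have : p * e ≤ (2 : ℝ) ^ (p * k) * e := by gcongr
      linarith
    rw [one_div, inv_pow, div_div, le_div_iff₀ (by positivity)]
    have v3 : (0 : ℝ) < 2 ^ (p * k) := by positivity
    have : 6 * ((k : ℝ) * (2 * (2 ^ (p * k) : ℝ)⁻¹)) * (s * 2) =
        24 * (k * s) / 2 ^ (p * k) := by field_simp; norm_num
    rw [this, div_le_iff₀ v3]
    linarith
  rw [← hb] at t1
  linarith

lemma classSandwichingDegree_le {𝓕 : Set (EuclideanSpace ℝ (Fin d) → ℝ)}
    {μ : Measure (EuclideanSpace ℝ (Fin d))} {ε s : ℝ} {ℓ : ℕ}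
    (h : ∀ f ∈ 𝓕, HasSandwichingPolynomials f μ ε s ℓ) :
    classSandwichingDegree 𝓕 μ ε s ≤ ℓ :=
  iSup₂_le fun f hf => iInf₂_le ℓ (h f hf)

/-- The degree budget: an extra factor `s` is absorbed by the squared logarithm. -/
lemma degree_budget {A e s X : ℝ} {k : ℕ} (hA : 1 ≤ A) (hk : 0 < k) (he : 0 < e) (he2 : e < 1 / 2)
    (hs : 1 ≤ s) (hX : X = (k : ℝ) ^ (5 / 2 : ℝ) * s / e ^ (s + 1)) :
    ((2 * (⌈A * ((k : ℝ) ^ 3 * s ^ 3 / (e ^ (s + 1)) ^ 2)⌉₊ * k) : ℕ) : ℝ) ≤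
      (2 * Real.sqrt A * X * Real.log (2 + X) ^ 1) ^ 2 := by
  have hs0 : 0 < s := by linarith
  have hk1 : (1 : ℝ) ≤ k := by exact_mod_cast hk
  have hk0 : (0 : ℝ) < k := by linarith
  have hB : 0 < e ^ (s + 1) := Real.rpow_pos_of_pos he _
  have hBle : e ^ (s + 1) ≤ (1 / 2) ^ (s + 1) :=
    Real.rpow_le_rpow he.le he2.le (by linarith)
  have hX2 : X ^ 2 = (k : ℝ) ^ 5 * s ^ 2 / (e ^ (s + 1)) ^ 2 := by
    rw [hX, div_pow, mul_pow, ← Real.rpow_natCast _ 2, ← Real.rpow_mul hk0.le]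
    norm_num
  have hX0 : 0 < X := by rw [hX]; positivity
  -- Here `e = ε/2 < 1/2` matters: `X` is exponentially large in `s`, so its logarithm controls `s`.
  have hXge : 2 ^ (s + 1) ≤ X := by
    have h1 : (1 : ℝ) ≤ (k : ℝ) ^ (5 / 2 : ℝ) * s :=
      one_le_mul_of_one_le_of_one_le (Real.one_le_rpow hk1 (by norm_num)) hs
    rw [hX, le_div_iff₀ hB]
    refine le_trans ?_ h1
    calc (2 : ℝ) ^ (s + 1) * e ^ (s + 1) ≤ 2 ^ (s + 1) * (1 / 2) ^ (s + 1) := by gcongr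
      _ = 1 := by
        rw [← Real.mul_rpow (by norm_num) (by norm_num)]; norm_num
  have hlog : (s + 1) * Real.log 2 ≤ Real.log (2 + X) := by
    rw [← Real.log_rpow (by norm_num)]
    exact Real.log_le_log (by positivity) (by linarith)
  -- Since `log 2 ≥ 1/2`, the squared logarithm is at least `((s+1)/2)² ≥ s`.
  have hlog2 : s ≤ Real.log (2 + X) ^ 2 := by
    have h2 := Real.log_two_gt_d9
    have h3 : (s + 1) * (1 / 2) ≤ Real.log (2 + X) := le_trans (by gcongr; linarith) hlog
    nlinarith [sq_nonneg (s - 1)]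
  set Y := (k : ℝ) ^ 3 * s ^ 3 / (e ^ (s + 1)) ^ 2 with hY
  have hY1 : 1 ≤ Y := by
    rw [hY, one_le_div (by positivity)]
    have h1 : e ^ (s + 1) ≤ 1 := Real.rpow_le_one he.le (by linarith) (by linarith)
    have h2 : (e ^ (s + 1)) ^ 2 ≤ 1 := pow_le_one₀ hB.le h1
    exact h2.trans (one_le_mul_of_one_le_of_one_le (one_le_pow₀ hk1) (one_le_pow₀ hs))
  have hceil : (⌈A * Y⌉₊ : ℝ) ≤ 2 * (A * Y) := by
    have h1 := Nat.ceil_lt_add_one (a := A * Y) (by positivity)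
    have h2 : 1 ≤ A * Y := one_le_mul_of_one_le_of_one_le hA hY1
    linarith
  have hYk : Y * k ≤ X ^ 2 * s := by
    rw [hX2, hY, div_mul_eq_mul_div, div_mul_eq_mul_div]
    refine div_le_div_of_nonneg_right ?_ (by positivity)
    have : (k : ℝ) ^ 4 * s ^ 3 ≤ k ^ 5 * s ^ 3 := by
      gcongr ?_ * _
      exact pow_le_pow_right₀ hk1 (by norm_num)
    linarith
  push_cast
  calc 2 * ((⌈A * Y⌉₊ : ℝ) * k) ≤ 2 * (2 * (A * Y) * k) := by gcongr
    _ = 4 * A * (Y * k) := by ring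
    _ ≤ 4 * A * (X ^ 2 * s) := by gcongr
    _ ≤ 4 * A * (X ^ 2 * Real.log (2 + X) ^ 2) := by gcongr
    _ = (2 * Real.sqrt A * X * Real.log (2 + X) ^ 1) ^ 2 := by
      rw [pow_one, mul_pow, mul_pow, mul_pow, Real.sq_sqrt (by linarith)]; ring

end Assembly

theorem theorem4p6 :
    ∃ C : ℝ, 0 < C ∧ ∃ c : ℕ, ∀ (d k : ℕ) (ε s : ℝ), k ≤ d → 0 < ε → ε < 1 → 1 ≤ s →
      ∀ X : ℝ, X = (k : ℝ) ^ (5 / 2 : ℝ) * s / (ε / 2) ^ (s + 1) →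
        ((classSandwichingDegree (convexConcepts d k)
            (stdGaussian (EuclideanSpace ℝ (Fin d))) ε s : ℕ∞) : ℝ≥0∞) ≤
          ENNReal.ofReal ((C * X * Real.log (2 + X) ^ c) ^ 2) := by
  obtain ⟨A, hA, hsand⟩ := exists_hasSandwichingPolynomials
  refine ⟨2 * Real.sqrt A, by positivity, 1, fun d k ε s _ hε hε1 hs X hX => ?_⟩
  -- For `k = 0` also `X = 0`, so the degree must be exactly zero; `f` is constant because `ℝ^0` is
  -- a point.
  rcases Nat.eq_zero_or_pos k with rfl | hk
  · have h : classSandwichingDegree (convexConcepts d 0)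
        (stdGaussian (EuclideanSpace ℝ (Fin d))) ε s ≤ (0 : ℕ) := by
      refine classSandwichingDegree_le ?_
      rintro f ⟨-, -, F, W, -, -, hfF⟩
      refine hasSandwichingPolynomials_of_const (c := F 0) (fun x => ?_) _ _ _ _
      rw [hfF]
      congr 1
      exact Subsingleton.elim _ _
    rw [Nat.cast_zero, nonpos_iff_eq_zero] at h
    rw [h]
    simp
  · have h := classSandwichingDegree_le (hsand d k ε s hk hε hε1 hs)
    refine (ENat.toENNReal_le.2 h).trans ?_
    rw [ENat.toENNReal_coe, ← ENNReal.ofReal_natCast]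
    exact ENNReal.ofReal_le_ofReal (degree_budget hA hk (by linarith) (by linarith) hs hX)
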